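/- Let $F$ be a free group of finite rank $k\ge 2$. Let $\partial F$ be its hyperbolic boundary and $\partial^2F=\{(\xi,\zeta)\in\partial F\times\partial F:\xi\neq\zeta\}$. A geodesic current on $F$ is a positive Borel measure on $\partial^2F$ that is finite on compact subsets and invariant under the left translation action of $F$. Let $cv(F)$ be the nonprojectivized outer space: the set of all minimal free and discrete isometric actions of $F$ on $\mathbb R$-trees, where two trees are considered equal if there is an $F$-equivariant isometry between them, with the equivariant Gromov--Hausdorff topology. A basis of it is given by the sets consisting of all $T'\in cv(F)$ for which there are points $x_1',\dots,x_n'\in T'$ with $|d_T(x_i,gx_j)-d_{T'}(x_i',gx_j')|<\varepsilon$ for all $i,j$ and all $g\in A$, where $T\in cv(F)$, $x_1,\dots,x_n\in T$, $A\subseteq F$ is finite and $\varepsilon>0$. For $T\in cv(F)$ identify $\partial F$ with $\partial T$ through the orbit map. For distinct $x,y\in T$ let $Cyl_{[x,y]}\subseteq\partial^2F$ be the set of all $(\zeta_1,\zeta_2)$ such that the oriented bi-infinite geodesic in $T$ from $\zeta_1$ to $\zeta_2$ contains the segment $[x,y]$ with agreeing orientation. The geometric entropy of a geodesic current $\mu$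 with respect to $T$ is $$h_T(\mu)=\liminf_{d_T(x,y)\to\infty}\frac{-\log\mu(Cyl_{[x,y]})}{d_T(x,y)},$$ where $\log 0=-\infty$. Let $\mu$ be a nonzero geodesic current on $F$. Then $h_T(\mu)$ is a finite real number for every $T\in cv(F)$, and the function $cv(F)\to\mathbb R$, $T\mapsto h_T(\mu)$, is continuous. -/

import Mathlib

open Filter Topology MeasureTheory

universe u

namespace OuterSpace

/-! ### The boundary of a free group and geodesic currents -/

/-- The hyperbolic boundary `∂F` of the free group `F = FreeGroup ι`: infinite reduced words in the
letters `(i, true) = i` and `(i, false) = i⁻¹`. -/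
def Boundary (ι : Type u) : Type u :=
  {ξ : ℕ → ι × Bool // ∀ n, ξ (n + 1) ≠ ((ξ n).1, !(ξ n).2)}

namespace Boundary

variable {ι : Type u}

/-- The topology induced by the product of the discrete topologies. -/
instance : TopologicalSpace (Boundary ι) :=
  TopologicalSpace.induced Subtype.val (@Pi.topologicalSpace ℕ (fun _ => ι × Bool) (fun _ => ⊥))

/-- The element of `F` given by the first `n` letters of `ξ`. -/
def initial (ξ : Boundary ι) (n : ℕ) : FreeGroup ι :=
  FreeGroup.mk (List.ofFn fun j : Fin n => ξ.1 j)

/-- Remove the first letter. -/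
def shift (ξ : Boundary ι) : Boundary ι := ⟨fun n => ξ.1 (n + 1), fun n => ξ.2 (n + 1)⟩

/-- Put a letter in front of a word, provided that no cancellation occurs. -/
def cons (a : ι × Bool) (ξ : Boundary ι) (h : ξ.1 0 ≠ (a.1, !a.2)) : Boundary ι :=
  ⟨fun n => Nat.casesOn n a ξ.1, fun n => by
    cases n with
    | zero => exact h
    | succ n => exact ξ.2 n⟩

open Classical in
/-- Left multiplication of an infinite reduced word by a letter, followed by free reduction. -/
noncomputable def letterMul (a : ι × Bool) (ξ : Boundary ι) : Boundary ι :=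
  if h : ξ.1 0 = (a.1, !a.2) then shift ξ else cons a ξ h

theorem letterMul_letterMul (a b : ι × Bool) (hab : b = (a.1, !a.2)) (ξ : Boundary ι) :
    letterMul b (letterMul a ξ) = ξ := by
  subst hab
  by_cases h : ξ.1 0 = (a.1, !a.2)
  · have h1 : letterMul a ξ = shift ξ := dif_pos h
    have h2 : ¬ (shift ξ).1 0 = (a.1, !(!a.2)) := by
      have := ξ.2 0
      rw [h] at this
      exact this
    rw [h1, letterMul, dif_neg h2]
    apply Subtype.ext
    funext n
    cases n with
    | zero => exact h.symm
    | succ n => rfl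
  · have h1 : letterMul a ξ = cons a ξ h := dif_neg h
    have h2 : (cons a ξ h).1 0 = (a.1, !(!a.2)) := by
      rw [Bool.not_not]
      rfl
    rw [h1, letterMul, dif_pos h2]
    rfl

/-- A free generator acts on `∂F` by left multiplication. -/
noncomputable def generatorPerm (i : ι) : Equiv.Perm (Boundary ι) where
  toFun := letterMul (i, true)
  invFun := letterMul (i, false)
  left_inv := letterMul_letterMul _ _ rfl
  right_inv := letterMul_letterMul _ _ rfl

/-- The left translation action of `F` on `∂F`. -/
noncomputable instance : MulAction (FreeGroup ι) (Boundary ι) :=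
  MulAction.compHom (Boundary ι) (FreeGroup.lift (generatorPerm (ι := ι)))

end Boundary

/-- `∂²F`: pairs of distinct points of `∂F`. -/
def DoubleBoundary (ι : Type u) : Type u :=
  {p : Boundary ι × Boundary ι // p.1 ≠ p.2}

namespace DoubleBoundary

variable {ι : Type u}

instance : TopologicalSpace (DoubleBoundary ι) := instTopologicalSpaceSubtype

/-- The Borel σ-algebra of `∂²F`. -/
instance : MeasurableSpace (DoubleBoundary ι) := borel _

instance : BorelSpace (DoubleBoundary ι) := ⟨rfl⟩

/-- The diagonal action of `F` on `∂²F`. -/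
noncomputable instance : MulAction (FreeGroup ι) (DoubleBoundary ι) where
  smul g p := ⟨(g • p.1.1, g • p.1.2), fun h => p.2 (MulAction.injective g h)⟩
  one_smul p := Subtype.ext (Prod.ext (one_smul _ p.1.1) (one_smul _ p.1.2))
  mul_smul g h p := Subtype.ext (Prod.ext (mul_smul g h p.1.1) (mul_smul g h p.1.2))

end DoubleBoundary

/-- A geodesic current on `F`: a positive Borel measure on `∂²F` that is finite on compact subsets
and `F`-invariant. -/
structure GeodesicCurrent (ι : Type u) where
  measure : Measure (DoubleBoundary ι)
  finiteOnCompacts : IsFiniteMeasureOnCompacts measure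
  invariant : SMulInvariantMeasure (FreeGroup ι) (DoubleBoundary ι) measure

/-! ### Trees with an action of the free group -/

/-- An `ℝ`-tree: a nonempty geodesic metric space that is `0`-hyperbolic (four-point condition). -/
structure IsRTree (X : Type*) [MetricSpace X] : Prop where
  nonempty : Nonempty X
  geodesic : ∀ x y : X, ∃ γ : ℝ → X, γ 0 = x ∧ γ (dist x y) = y ∧
    ∀ s ∈ Set.Icc 0 (dist x y), ∀ t ∈ Set.Icc 0 (dist x y), dist (γ s) (γ t) = |s - t|
  fourPoint : ∀ x y z w : X,
    dist x y + dist z w ≤ max (dist x z + dist y w) (dist x w + dist y z)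

/-- A subset of an `ℝ`-tree is a subtree if it is nonempty and contains the geodesic segment
`{z | d(x,z) + d(z,y) = d(x,y)}` between any two of its points. -/
def IsSubtree {X : Type*} [MetricSpace X] (S : Set X) : Prop :=
  S.Nonempty ∧ ∀ x ∈ S, ∀ y ∈ S, ∀ z, dist x z + dist z y = dist x y → z ∈ S

/-- An `ℝ`-tree with a minimal free and discrete isometric action of `F = FreeGroup ι`.
(For `ι` countable, such a tree has the cardinality of the continuum, so that, up to equivariant
isometry, every one has a carrier in `Type`.) -/
structure FreeTree (ι : Type u) where
  carrier : Type
  [metricSpace : MetricSpace carrier]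
  [mulAction : MulAction (FreeGroup ι) carrier]
  [isometric : IsIsometricSMul (FreeGroup ι) carrier]
  isRTree : IsRTree carrier
  /-- The action is free. -/
  free : ∀ (g : FreeGroup ι) (x : carrier), g • x = x → g = 1
  /-- The action is discrete. -/
  discrete : ∀ (x : carrier) (R : ℝ), {g : FreeGroup ι | dist x (g • x) ≤ R}.Finite
  /-- There is no proper invariant subtree. -/
  minimal : ∀ S : Set carrier, IsSubtree S →
    (∀ g : FreeGroup ι, ∀ x ∈ S, g • x ∈ S) → S = Set.univ

attribute [instance] FreeTree.metricSpace FreeTree.mulAction FreeTree.isometric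

namespace FreeTree

variable {ι : Type u}

instance : CoeSort (FreeTree ι) Type := ⟨FreeTree.carrier⟩

/-- Equality of points of `cv(F)`: there is an `F`-equivariant isometry. -/
instance setoid (ι : Type u) : Setoid (FreeTree ι) where
  r T T' := ∃ e : T ≃ᵢ T', ∀ (g : FreeGroup ι) (x : T), e (g • x) = g • e x
  iseqv :=
    { refl := fun T => ⟨IsometryEquiv.refl T, fun _ _ => rfl⟩
      symm := fun ⟨e, he⟩ => ⟨e.symm, fun g x => by
        apply e.injective
        rw [he]
        simp⟩
      trans := fun ⟨e, he⟩ ⟨f, hf⟩ => ⟨e.trans f, fun g x => by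
        simp [he, hf]⟩ }

/-- The Gromov product `(x | y)_p`. -/
noncomputable def gromovProduct {X : Type*} [MetricSpace X] (p x y : X) : ℝ :=
  (dist p x + dist p y - dist x y) / 2

/-- The ray `t ↦ γ t`, `t → ∞`, in `T` ends at the point of `∂T` that is identified with `ξ ∈ ∂F`
through the orbit map `g ↦ g • p`: the ray and the sequence `(ξ₁ ⋯ ξₙ) • p` converge to the same
point of the hyperbolic boundary of `T`. -/
def EndsAt (T : FreeTree ι) (γ : ℝ → T) (ξ : Boundary ι) : Prop :=
  ∀ p : T, Tendsto (fun a : ℝ × ℕ => gromovProduct p (γ a.1) (ξ.initial a.2 • p))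
    (atTop ×ˢ atTop) atTop

/-- The two-sided cylinder `Cyl_{[x,y]}`: the pairs `(ζ₁, ζ₂)` such that the oriented geodesic line
from `ζ₁` to `ζ₂` in `T` passes through `[x,y]`, from `x` to `y`. -/
def cylinder (T : FreeTree ι) (x y : T) : Set (DoubleBoundary ι) :=
  {ζ | ∃ γ : ℝ → T, Isometry γ ∧ γ 0 = x ∧ γ (dist x y) = y ∧
    T.EndsAt (fun t => γ (-t)) ζ.1.1 ∧ T.EndsAt γ ζ.1.2}

/-- The geometric entropy
`h_T(μ) = liminf_{d(x,y) → ∞} (-log μ(Cyl_{[x,y]})) / d(x,y)`, with `log 0 = -∞`. -/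
noncomputable def geometricEntropy (T : FreeTree ι) (μ : GeodesicCurrent ι) : EReal :=
  liminf (fun p : T × T => -(ENNReal.log (μ.measure (T.cylinder p.1 p.2))) /
    ((dist p.1 p.2 : ℝ) : EReal)) (comap (fun p : T × T => dist p.1 p.2) atTop)

theorem EndsAt.map {T T' : FreeTree ι} (e : T ≃ᵢ T')
    (he : ∀ (g : FreeGroup ι) (x : T), e (g • x) = g • e x) {γ : ℝ → T} {ξ : Boundary ι}
    (h : T.EndsAt γ ξ) : T'.EndsAt (fun t => e (γ t)) ξ := by
  intro p
  obtain ⟨p, rfl⟩ := e.surjective p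
  simpa only [gromovProduct, ← he, e.dist_eq] using h p

theorem cylinder_subset {T T' : FreeTree ι} (e : T ≃ᵢ T')
    (he : ∀ (g : FreeGroup ι) (x : T), e (g • x) = g • e x) (x y : T) :
    T.cylinder x y ⊆ T'.cylinder (e x) (e y) := by
  rintro ζ ⟨γ, hγ, h0, h1, h2, h3⟩
  refine ⟨fun t => e (γ t), e.isometry.comp hγ, by simp [h0], ?_, h2.map e he, h3.map e he⟩
  simp [e.dist_eq, h1]

theorem cylinder_eq {T T' : FreeTree ι} (e : T ≃ᵢ T')
    (he : ∀ (g : FreeGroup ι) (x : T), e (g • x) = g • e x) (x y : T) :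
    T'.cylinder (e x) (e y) = T.cylinder x y := by
  refine Set.Subset.antisymm ?_ (cylinder_subset e he x y)
  have he' : ∀ (g : FreeGroup ι) (x : T'), e.symm (g • x) = g • e.symm x := fun g x => by
    apply e.injective
    rw [he]
    simp
  simpa using cylinder_subset e.symm he' (e x) (e y)

/-- Equivariantly isometric trees have the same geometric entropy. -/
theorem geometricEntropy_congr (μ : GeodesicCurrent ι) (T T' : FreeTree ι) (h : T ≈ T') :
    T.geometricEntropy μ = T'.geometricEntropy μ := by
  obtain ⟨e, he⟩ := h
  let E : T × T ≃ T' × T' := e.toEquiv.prodCongr e.toEquiv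
  have hE : ∀ p : T × T, dist (E p).1 (E p).2 = dist p.1 p.2 := fun p => e.dist_eq _ _
  have hf : comap (fun p : T' × T' => dist p.1 p.2) atTop =
      map E (comap (fun p : T × T => dist p.1 p.2) atTop) := by
    have h1 : (fun p : T × T => dist p.1 p.2) = (fun p : T' × T' => dist p.1 p.2) ∘ E := by
      funext p
      exact (hE p).symm
    rw [h1, ← comap_comap, map_comap_of_surjective E.surjective]
  unfold geometricEntropy
  rw [hf, liminf, liminf, map_map]
  congr 2
  funext p
  have h2 : T'.cylinder (E p).1 (E p).2 = T.cylinder p.1 p.2 := cylinder_eq e he _ _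
  simp only [Function.comp, h2, hE]

end FreeTree

/-! ### The space `cv(F)` -/

/-- The nonprojectivized outer space `cv(F)` of `F = FreeGroup ι`. -/
def CV (ι : Type u) : Type (max u 1) := Quotient (FreeTree.setoid ι)

namespace CV

variable {ι : Type u}

/-- The basic set of the equivariant Gromov–Hausdorff topology given by a tree `T`, a finite set
`s` of points of `T`, a finite set `A ⊆ F` and `ε`: the trees `T'` for which there are points `x'`
of `T'`, `x ∈ s`, with `|d(x, g y) - d(x', g y')| < ε` for all `x, y ∈ s`, `g ∈ A`. -/
def basicNhd (T : FreeTree ι) (s : Finset T) (A : Finset (FreeGroup ι)) (ε : ℝ) : Set (CV ι) :=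
  {X | ∃ T' : FreeTree ι, (Quotient.mk _ T' : CV ι) = X ∧ ∃ f : T → T',
    ∀ x ∈ s, ∀ y ∈ s, ∀ g ∈ A, |dist x (g • y) - dist (f x) (g • f y)| < ε}

/-- The equivariant Gromov–Hausdorff topology on `cv(F)`. -/
instance : TopologicalSpace (CV ι) :=
  TopologicalSpace.generateFrom
    {U | ∃ (T : FreeTree ι) (s : Finset T) (A : Finset (FreeGroup ι)) (ε : ℝ),
      0 < ε ∧ U = basicNhd T s A ε}

/-- The geometric entropy `h_T(μ)` of a current `μ` with respect to a point `T` of `cv(F)`. -/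
noncomputable def geometricEntropy (μ : GeodesicCurrent ι) (T : CV ι) : EReal :=
  Quotient.lift (fun T : FreeTree ι => T.geometricEntropy μ)
    (FreeTree.geometricEntropy_congr μ) T

end CV

end OuterSpace

namespace OuterSpace

/-! The entropy is governed by heavy cylinders: `h_T(μ)` is the infimum of the rates `s` for which
arbitrarily long segments `[x, y]` of `T` have cylinders of mass at least `exp (-s d(x, y))`
(`hasHeavyCylinders_of_lt`, `HasHeavyCylinders.geometricEntropy_le`).

Finiteness. The action is cobounded, so one translate of a fixed compact subset of `∂²F` contains
any given nondegenerate cylinder. Cylinder masses are therefore bounded, and no negative rate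
occurs. Conversely some cylinder has positive mass, because countably many cylinders cover `∂²F`.
Each cylinder is covered by at most `N` cylinders over segments longer by 1, so passing to the
heaviest one repeatedly loses mass at most exponentially (`exists_hasHeavyCylinders`).

Continuity. Suppose `d'(p', g p') ≤ r d(p, g p) + C` for all `g`. Bounded cancellation
(`exists_gromovProduct_bound`) places each cylinder of `T'` over a long segment inside a cylinder of
`T` whose length is coarsely at least `1/r` times as large (`exists_cylinder_subset`). Heavy
cylinders thus pass from `T'` to `T`, the additive errors vanish in the limit, and `h_T(μ) ≤ r
h_{T'}(μ)` (`toReal_geometricEntropy_le_mul`). If the displacements of one point under a large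
finite set of group elements agree up to 1, a local-to-global argument for chains gives this
comparison in both directions with `r = 1 + δ` (`exists_finset_comparison`). The absolute tolerance
1 suffices, since it is negligible against the length of the steps. -/

/-- The point `z` lies on the geodesic segment from `x` to `y`. -/
def Btw {X : Type*} [MetricSpace X] (x z y : X) : Prop := dist x z + dist z y = dist x y

/-! ### Gromov products and geodesics in `ℝ`-trees -/

section Metric

variable {X : Type*} [MetricSpace X]

local notation "gp" => FreeTree.gromovProduct

theorem Btw.symm {x y z : X} (h : Btw x z y) : Btw y z x := by
  unfold Btw at *
  linarith [dist_comm x z, dist_comm z y, dist_comm x y]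

theorem gromovProduct_comm (p x y : X) : gp p x y = gp p y x := by
  unfold FreeTree.gromovProduct
  rw [dist_comm x y]
  ring

theorem gromovProduct_le_add_dist (p q x y : X) : gp p x y ≤ gp q x y + dist p q := by
  unfold FreeTree.gromovProduct
  linarith [dist_triangle p q x, dist_triangle p q y]

theorem gromovProduct_le_add_dist_right (p x y y' : X) :
    gp p x y ≤ gp p x y' + dist y y' := by
  unfold FreeTree.gromovProduct
  linarith [dist_triangle x y y', dist_triangle p y' y, dist_comm y y']

theorem gromovProduct_le_add_dist_left (p x x' y : X) :
    gp p x y ≤ gp p x' y + dist x x' := by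
  rw [gromovProduct_comm p x y, gromovProduct_comm p x' y]
  exact gromovProduct_le_add_dist_right p y x x'

theorem sub_dist_le_gromovProduct (p x y : X) : dist p x - dist x y ≤ gp p x y := by
  unfold FreeTree.gromovProduct
  linarith [dist_triangle p y x, dist_comm x y]

theorem gromovProduct_le_left (p x y : X) : gp p x y ≤ dist p x := by
  unfold FreeTree.gromovProduct
  linarith [dist_triangle p x y]

theorem gromovProduct_nonneg (p x y : X) : 0 ≤ gp p x y := by
  unfold FreeTree.gromovProduct
  linarith [dist_triangle x p y, dist_comm x p]

theorem gromovProduct_add_gromovProduct (p x y : X) : gp p x y + gp x p y = dist p x := by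
  unfold FreeTree.gromovProduct
  linarith [dist_comm x p]

theorem btw_iff_gromovProduct_eq_zero {x y z : X} : Btw x z y ↔ gp z x y = 0 := by
  unfold FreeTree.gromovProduct Btw
  rw [dist_comm z x]
  constructor <;> intro h <;> linarith

theorem gromovProduct_smul {G : Type*} [Group G] [MulAction G X] [IsIsometricSMul G X] (g : G)
    (p x y : X) : gp (g • p) (g • x) (g • y) = gp p x y := by
  simp [FreeTree.gromovProduct]

theorem Btw.smul {G : Type*} [Group G] [MulAction G X] [IsIsometricSMul G X] (g : G)
    {x y z : X} (h : Btw x z y) : Btw (g • x) (g • z) (g • y) := by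
  simpa [Btw] using h

theorem Btw.dist_le_gromovProduct {p x y z : X} (hx : Btw p z x) (hy : Btw p z y) :
    dist p z ≤ gp p x y := by
  unfold Btw at *
  unfold FreeTree.gromovProduct
  linarith [dist_triangle x z y, dist_comm x z]

/-- Moving endpoints along a geodesic. -/
theorem Btw.trans_left {x z w y : X} (h : Btw x z y) (h' : Btw x w z) : Btw w z y := by
  unfold Btw at *
  linarith [dist_triangle x w y, dist_triangle w z y]

theorem Btw.trans {x z w y : X} (h : Btw x z y) (h' : Btw x w z) : Btw x w y := by
  unfold Btw at *
  linarith [dist_triangle x w y, dist_triangle w z y]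

namespace IsRTree

variable (hX : IsRTree X)
include hX

theorem exists_btw (x y : X) {t : ℝ} (h0 : 0 ≤ t) (h1 : t ≤ dist x y) :
    ∃ z, Btw x z y ∧ dist x z = t := by
  obtain ⟨γ, hγ0, hγ1, hγ⟩ := hX.geodesic x y
  have hxy : 0 ≤ dist x y := dist_nonneg
  have a := hγ 0 ⟨le_rfl, hxy⟩ t ⟨h0, h1⟩
  have b := hγ t ⟨h0, h1⟩ _ ⟨hxy, le_rfl⟩
  rw [hγ0, zero_sub, abs_neg, abs_of_nonneg h0] at a
  rw [hγ1, abs_sub_comm, abs_of_nonneg (by linarith)] at b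
  exact ⟨γ t, by unfold Btw; linarith, a⟩

/-- Gromov's inequality with `δ = 0`. -/
theorem min_gromovProduct_le (p x y z : X) : min (gp p x y) (gp p y z) ≤ gp p x z := by
  unfold FreeTree.gromovProduct
  rcases le_max_iff.1 (hX.fourPoint x z y p) with h | h
  · apply min_le_of_left_le
    linarith [dist_comm y z, dist_comm y p, dist_comm z p, dist_comm x p]
  · apply min_le_of_right_le
    linarith [dist_comm y z, dist_comm y p, dist_comm z p, dist_comm x p]

/-- Removing `z` separates `x` from `y`, so `w` is separated from at least one of them. -/
theorem btw_or {x y z : X} (h : Btw x z y) (w : X) : Btw x z w ∨ Btw w z y := by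
  simp only [btw_iff_gromovProduct_eq_zero] at *
  rcases min_le_iff.1 (hX.min_gromovProduct_le z x w y) with h' | h'
  · exact .inl (le_antisymm (h ▸ h') (gromovProduct_nonneg _ _ _))
  · exact .inr (le_antisymm (h ▸ h') (gromovProduct_nonneg _ _ _))

theorem dist_eq_abs {x y z w : X} (hz : Btw x z y) (hw : Btw x w y) :
    dist z w = |dist x z - dist x w| := by
  unfold Btw at *
  refine le_antisymm ?_ ?_
  · rcases le_max_iff.1 (hX.fourPoint x y z w) with h | h
    · exact le_trans (by linarith [dist_comm w y]) (le_abs_self _)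
    · exact le_trans (by linarith [dist_comm w y, dist_comm y z]) (neg_le_abs _)
  · rw [abs_le]
    constructor <;> linarith [dist_triangle x z w, dist_triangle x w z, dist_comm z w]

theorem btw_eq {x y z w : X} (hz : Btw x z y) (hw : Btw x w y) (h : dist x z = dist x w) :
    z = w := by
  rw [← dist_eq_zero, hX.dist_eq_abs hz hw, h, sub_self, abs_zero]

theorem btw_of_le {x y z w : X} (hz : Btw x z y) (hw : Btw x w y) (h : dist x z ≤ dist x w) :
    Btw x z w := by
  have := hX.dist_eq_abs hz hw
  rw [abs_sub_comm, abs_of_nonneg (by linarith)] at this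
  unfold Btw
  linarith

/-- The initial part of length `(u | v)_x` of `[x, u]` lies on `[x, v]`. -/
theorem btw_of_le_gromovProduct {x u v z : X} (hz : Btw x z u) (h : dist x z ≤ gp x u v) :
    Btw x z v := by
  rcases le_max_iff.1 (hX.fourPoint x u z v) with h' | h' <;>
  · unfold Btw FreeTree.gromovProduct at *
    linarith [dist_comm u z, dist_triangle x z v]

/-- Past the branch point of `[x, u]` and `[x, v]`, the rest of `[x, u]` belongs to `[v, u]`. -/
theorem btw_of_gromovProduct_le {x u v z : X} (hz : Btw x z u) (h : gp x u v ≤ dist x z) :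
    Btw v z u := by
  rcases le_max_iff.1 (hX.fourPoint x u z v) with h' | h' <;>
  · unfold Btw FreeTree.gromovProduct at *
    linarith [dist_comm u z, dist_comm v z, dist_comm u v, dist_triangle v z u]

/-- Two overlapping geodesics concatenate. -/
theorem dist_eq_of_overlap {a x y b : X} (hxy : x ≠ y) (ha : Btw a x y) (hb : Btw x y b) :
    dist a x + dist x y + dist y b = dist a b := by
  have := dist_pos.2 hxy
  unfold Btw at *
  rcases le_max_iff.1 (hX.fourPoint a y x b) with h' | h' <;>
  linarith [dist_comm y x, dist_triangle a x b, dist_triangle x y b]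

/-- Gromov's inequality iterates without loss when `δ = 0`: the product of the ends is at least the
smallest product of neighbours. -/
theorem exists_gromovProduct_le_chain (p : X) (c : ℕ → X) {i j : ℕ} (hij : i < j) :
    ∃ k, i ≤ k ∧ k < j ∧ gp p (c k) (c (k + 1)) ≤ gp p (c i) (c j) := by
  induction j, hij using Nat.le_induction with
  | base => exact ⟨i, le_rfl, Nat.lt_succ_self i, le_rfl⟩
  | succ j hij ih =>
    rcases min_le_iff.1 (hX.min_gromovProduct_le p (c i) (c j) (c (j + 1))) with h | h
    · obtain ⟨k, h1, h2, h3⟩ := ih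
      exact ⟨k, h1, by omega, h3.trans h⟩
    · exact ⟨j, by omega, by omega, h⟩

/-- A chain with small steps passes near every point of the geodesic between its endpoints. -/
theorem exists_dist_le_chain (c : ℕ → X) {m : ℕ} {K : ℝ} (hK : 0 ≤ K)
    (hc : ∀ i < m, dist (c i) (c (i + 1)) ≤ K) {z : X} (hz : Btw (c 0) z (c m)) :
    ∃ i ≤ m, dist z (c i) ≤ K := by
  rcases Nat.eq_zero_or_pos m with rfl | hm
  · refine ⟨0, le_rfl, ?_⟩
    unfold Btw at hz
    rw [dist_self] at hz
    linarith [dist_nonneg (x := c 0) (y := z)]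
  · obtain ⟨k, -, hk, h⟩ := hX.exists_gromovProduct_le_chain z c hm
    rw [btw_iff_gromovProduct_eq_zero.1 hz] at h
    refine ⟨k, hk.le, ?_⟩
    linarith [sub_dist_le_gromovProduct z (c k) (c (k + 1)), hc k hk]

/-- Local-to-global principle for chains. -/
theorem mul_le_dist_chain (c : ℕ → X) {m : ℕ} {K L : ℝ} (hK : 0 ≤ K) (hL : 2 * K < L)
    (h1 : ∀ i < m, L ≤ dist (c i) (c (i + 1)))
    (h2 : ∀ i, i + 2 ≤ m → gp (c (i + 1)) (c i) (c (i + 2)) ≤ K) :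
    m * (L - 2 * K) ≤ dist (c 0) (c m) := by
  -- The induction also carries small backtracking at `c n` as seen from `c 0`. This makes the
  -- product of `c 0` and `c n` at `c (n + 1)` at least `L - K > K`, so Gromov's inequality
  -- transfers the local bound there to `c 0`. Each step then gains at least `L - 2 * K`.
  suffices h : ∀ n, n + 1 ≤ m → ((n + 1 : ℕ) : ℝ) * (L - 2 * K) ≤ dist (c 0) (c (n + 1)) ∧
      gp (c n) (c 0) (c (n + 1)) ≤ K by
    cases m with
    | zero => simp
    | succ n => exact (h n le_rfl).1
  intro n hn
  induction n with
  | zero =>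
    have := h1 0 hn
    refine ⟨by simp only [zero_add, Nat.cast_one, one_mul]; linarith, ?_⟩
    exact (gromovProduct_le_left _ _ _).trans (by rw [dist_self]; exact hK)
  | succ n ih =>
    obtain ⟨ih1, ih2⟩ := ih (by omega)
    have a := gromovProduct_add_gromovProduct (c n) (c (n + 1)) (c 0)
    rw [gromovProduct_comm (c n), gromovProduct_comm (c (n + 1))] at a
    have b := h1 n (by omega)
    have key : gp (c (n + 1)) (c 0) (c (n + 1 + 1)) ≤ K := by
      by_contra! hlt
      have := hX.min_gromovProduct_le (c (n + 1)) (c n) (c 0) (c (n + 1 + 1))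
      rw [gromovProduct_comm _ (c n) (c 0)] at this
      have h3 := h2 n hn
      rcases min_le_iff.1 (this.trans h3) with h | h <;> linarith
    refine ⟨?_, key⟩
    have d := h1 (n + 1) (by omega)
    unfold FreeTree.gromovProduct at key
    push_cast at *
    linarith [dist_comm (c (n + 1)) (c 0)]

end IsRTree

end Metric

/-! ### Orbits: coboundedness, comparison of trees, bounded cancellation -/

namespace FreeTree

variable {ι : Type u}

theorem dist_smul_smul_eq (T : FreeTree ι) (p : T) (g h : FreeGroup ι) :
    dist (g • p) (h • p) = dist p ((g⁻¹ * h) • p) := by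
  rw [← dist_smul g p, smul_smul, mul_inv_cancel_left]

/-- The balls of one orbit metric are bounded in every other orbit metric. -/
theorem exists_orbit_bound (T T' : FreeTree ι) (p : T) (p' : T') (R : ℝ) :
    ∃ C, 0 ≤ C ∧ ∀ g : FreeGroup ι, dist p (g • p) ≤ R → dist p' (g • p') ≤ C := by
  obtain ⟨C, hC⟩ := ((T.discrete p R).image fun g => dist p' (g • p')).bddAbove
  refine ⟨max C 0, le_max_right _ _, fun g hg => ?_⟩
  exact (hC ⟨g, hg, rfl⟩).trans (le_max_left _ _)

theorem exists_letter_bound [Finite ι] (T : FreeTree ι) (p : T) :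
    ∃ K, 0 ≤ K ∧ ∀ a : ι × Bool, dist p (FreeGroup.mk [a] • p) ≤ K := by
  obtain ⟨C, hC⟩ :=
    (Set.finite_range fun a : ι × Bool => dist p (FreeGroup.mk [a] • p)).bddAbove
  exact ⟨max C 0, le_max_right _ _, fun a => (hC ⟨a, rfl⟩).trans (le_max_left _ _)⟩

/-- The action on a minimal tree is cobounded. -/
theorem exists_cobounded [Finite ι] (T : FreeTree ι) (p : T) :
    ∃ K, 0 ≤ K ∧ ∀ x : T, ∃ g : FreeGroup ι, dist x (g • p) ≤ K := by
  obtain ⟨K, hK, hKa⟩ := T.exists_letter_bound p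
  have hT := T.isRTree
  -- `S` is the union of the translates of short segments `[p, h p]`. Peeling off letters shows that
  -- it contains every segment between orbit points, so it is an invariant subtree and minimality
  -- applies.
  let S : Set T := {x | ∃ g h : FreeGroup ι, dist p (h • p) ≤ K ∧ Btw (g • p) x (g • h • p)}
  have key : ∀ (l : List (ι × Bool)) (g : FreeGroup ι) (z : T),
      Btw (g • p) z (g • FreeGroup.mk l • p) → z ∈ S := by
    intro l
    induction l with
    | nil =>
      intro g z hz
      refine ⟨g, 1, by simpa using hK, ?_⟩
      rwa [← FreeGroup.one_eq_mk] at hz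
    | cons a l ih =>
      intro g z hz
      rcases hT.btw_or hz (g • FreeGroup.mk [a] • p) with h | h
      · exact ⟨g, _, hKa a, h⟩
      · refine ih (g * FreeGroup.mk [a]) z ?_
        rwa [mul_smul, smul_smul (g * _), mul_assoc, FreeGroup.mul_mk, mul_smul]
  have key' : ∀ (g h : FreeGroup ι) (z : T), Btw (g • p) z (h • p) → z ∈ S := by
    intro g h z hz
    obtain ⟨l, hl⟩ : ∃ l, FreeGroup.mk l = g⁻¹ * h := Quot.exists_rep _
    refine key l g z ?_
    rwa [hl, smul_smul, mul_inv_cancel_left]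
  have hS : S = Set.univ := by
    refine T.minimal S ⟨⟨p, 1, 1, by simpa using hK, by simp [Btw]⟩, ?_⟩ ?_
    · rintro x ⟨g, h, -, hx⟩ y ⟨g', h', -, hy⟩ z hz
      rw [smul_smul] at hx hy
      rcases hT.btw_or (x := x) (y := y) hz (g • p) with h1 | h1
      · exact key' _ _ z (hx.trans h1.symm)
      · rcases hT.btw_or h1 (g' • p) with h2 | h2
        · exact key' _ _ z h2
        · exact key' _ _ z (hy.trans h2)
    · rintro f x ⟨g, h, hh, hx⟩
      refine ⟨f * g, h, hh, ?_⟩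
      rw [mul_smul, mul_smul]
      exact hx.smul f
  refine ⟨K, hK, fun x => ?_⟩
  obtain ⟨g, h, hh, hx⟩ : x ∈ S := hS ▸ Set.mem_univ x
  refine ⟨g, ?_⟩
  unfold Btw at hx
  rw [dist_smul] at hx
  linarith [dist_comm x (g • p), dist_nonneg (x := x) (y := g • h • p)]

/-- Points subdividing a segment into pieces of length `L`. -/
theorem exists_subdivision (T : FreeTree ι) (x y : T) {L : ℝ} (hL : 0 ≤ L) :
    ∃ q : ℕ → T, ∀ i, Btw x (q i) y ∧ dist x (q i) = min (i * L) (dist x y) := by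
  have h : ∀ i : ℕ, ∃ z, Btw x z y ∧ dist x z = min (i * L) (dist x y) := fun i =>
    T.isRTree.exists_btw x y (le_min (by positivity) dist_nonneg) (min_le_right _ _)
  choose q hq using h
  exact ⟨q, hq⟩

/-- Trees whose orbit metrics are close on a suitable finite set have coarsely close orbit
metrics. -/
theorem exists_finset_comparison [Finite ι] (T : FreeTree ι) (p : T) {δ : ℝ} (hδ : 0 < δ) :
    ∃ A : Finset (FreeGroup ι), ∀ (T' : FreeTree ι) (p' : T'),
      (∀ g ∈ A, |dist p (g • p) - dist p' (g • p')| < 1) →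
      ∃ C, ∀ g : FreeGroup ι, dist p' (g • p') ≤ (1 + δ) * dist p (g • p) + C ∧
        dist p (g • p) ≤ (1 + δ) * dist p' (g • p') + C := by
  obtain ⟨K, hK, hcob⟩ := T.exists_cobounded p
  -- In `T'` the steps of the chain will have length at least `L - 2K - 1` and backtracking at most
  -- `3K + 2`, so each contributes at least `L - (8K + 5)`. The second condition makes this at least
  -- `L / (1 + δ)`.
  obtain ⟨L, hL1, hL2⟩ : ∃ L, 8 * K + 5 < L ∧ (1 + δ) * (8 * K + 5) ≤ δ * L := by
    refine ⟨(1 + δ) * (8 * K + 5) / δ + (8 * K + 6), ?_, ?_⟩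
    · have : 0 ≤ (1 + δ) * (8 * K + 5) / δ := by positivity
      linarith
    · rw [mul_add δ, mul_div_cancel₀ _ hδ.ne']
      have : 0 ≤ δ * (8 * K + 6) := by positivity
      linarith
  have hL0 : 0 < L := by linarith
  -- The radius covers two consecutive steps of length `L`, with an error `K` at each end, so that
  -- backtracking is controlled too.
  refine ⟨(T.discrete p (2 * L + 2 * K)).toFinset, fun T' p' hA => ?_⟩
  simp only [Set.Finite.mem_toFinset, Set.mem_ofPred_eq] at hA
  have hA' : ∀ g h : FreeGroup ι, dist (g • p) (h • p) ≤ 2 * L + 2 * K →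
      |dist (g • p) (h • p) - dist (g • p') (h • p')| < 1 := by
    intro g h hgh
    rw [dist_smul_smul_eq] at hgh
    rw [dist_smul_smul_eq, dist_smul_smul_eq]
    exact hA _ hgh
  -- `C` accounts for the two ends of the chain. It may depend on `T'`, since only the
  -- multiplicative constant matters.
  obtain ⟨C, hC, hCb⟩ := exists_orbit_bound T T' p p' (K + L)
  have hCb' : ∀ g h : FreeGroup ι, dist (g • p) (h • p) ≤ K + L →
      dist (g • p') (h • p') ≤ C := by
    intro g h hgh
    rw [dist_smul_smul_eq] at hgh ⊢
    exact hCb _ hgh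
  refine ⟨(1 + δ) * (2 * C) + L, fun g => ?_⟩
  obtain ⟨q, hq⟩ := T.exists_subdivision p (g • p) hL0.le
  choose c hc using fun i => hcob (q i)
  set d := dist p (g • p) with hd
  set m := ⌊d / L⌋₊ with hm
  have hm1 : m * L ≤ d := by
    rw [← le_div_iff₀ hL0]
    exact Nat.floor_le (by positivity)
  have hm2 : d ≤ (m + 1) * L := by
    rw [← div_le_iff₀ hL0]
    exact (Nat.lt_floor_add_one _).le
  have hqi : ∀ i ≤ m, dist p (q i) = i * L := by
    intro i hi
    rw [(hq i).2]
    refine min_eq_left (le_trans ?_ hm1)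
    gcongr
  have hqq : ∀ i j, i ≤ m → j ≤ m → dist (q i) (q j) = |(i : ℝ) - j| * L := by
    intro i j hi hj
    rw [T.isRTree.dist_eq_abs (hq i).1 (hq j).1, hqi i hi, hqi j hj, ← sub_mul, abs_mul,
      abs_of_pos hL0]
  have hcc : ∀ i j, i ≤ m → j ≤ m →
      |dist (c i • p) (c j • p) - |(i : ℝ) - j| * L| ≤ 2 * K := by
    intro i j hi hj
    rw [← hqq i j hi hj, abs_le]
    have h1 := hc i
    have h2 := hc j
    constructor
    · linarith [dist_triangle4 (q i) (c i • p) (c j • p) (q j), dist_comm (c j • p) (q j)]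
    · linarith [dist_triangle4 (c i • p) (q i) (q j) (c j • p), dist_comm (c i • p) (q i)]
  have step1 : ∀ i < m, |dist (c i • p') (c (i + 1) • p') - L| ≤ 2 * K + 1 := by
    intro i hi
    have h := hcc i (i + 1) hi.le hi
    push_cast at h
    rw [sub_add_cancel_left, abs_neg, abs_one, one_mul, abs_le] at h
    have h' := hA' (c i) (c (i + 1)) (by linarith)
    rw [abs_lt] at h'
    rw [abs_le]
    constructor <;> linarith
  have step2 : ∀ i, i + 2 ≤ m → 2 * L - 2 * K - 1 ≤ dist (c i • p') (c (i + 2) • p') := by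
    intro i hi
    have h := hcc i (i + 2) (by omega) hi
    push_cast at h
    rw [sub_add_cancel_left, abs_neg, abs_two, abs_le] at h
    have h' := hA' (c i) (c (i + 2)) (by linarith)
    rw [abs_lt] at h'
    linarith
  have hend0 : dist p' (c 0 • p') ≤ C := by
    refine hCb _ ?_
    have h0 : dist p (q 0) = 0 := by simpa using hqi 0 (Nat.zero_le _)
    linarith [dist_triangle p (q 0) (c 0 • p), hc 0]
  have hend1 : dist (c m • p') (g • p') ≤ C := by
    refine hCb' _ _ ?_
    have h0 : dist (q m) (g • p) ≤ L := by
      have := (hq m).1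
      unfold Btw at this
      rw [hqi m le_rfl] at this
      linarith
    linarith [dist_triangle (c m • p) (q m) (g • p), hc m, dist_comm (c m • p) (q m)]
  constructor
  · have h1 : dist (c 0 • p') (c m • p') ≤ m * (L + 2 * K + 1) := by
      have h2 : ∀ n ≤ m, dist (c 0 • p') (c n • p') ≤ n * (L + 2 * K + 1) := by
        intro n hn
        induction n with
        | zero => simp
        | succ n ih =>
          have h3 := abs_le.1 (step1 n hn)
          push_cast
          linarith [ih (by omega), dist_triangle (c 0 • p') (c n • p') (c (n + 1) • p')]
      exact h2 m le_rfl
    have h2 : (m : ℝ) * (L + 2 * K + 1) ≤ (1 + δ) * (m * L) := by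
      have : 0 ≤ δ * (8 * K + 5) := by positivity
      have h3 : L + 2 * K + 1 ≤ (1 + δ) * L := by linarith
      calc (m : ℝ) * (L + 2 * K + 1) ≤ m * ((1 + δ) * L) := by gcongr
        _ = (1 + δ) * (m * L) := by ring
    have h3 : (1 + δ) * (m * L) ≤ (1 + δ) * d := by gcongr
    have h4 : 0 ≤ δ * (2 * C) := by positivity
    linarith [dist_triangle4 p' (c 0 • p') (c m • p') (g • p')]
  · have h1 := T'.isRTree.mul_le_dist_chain (fun i => c i • p') (m := m) (K := 3 * K + 2)
      (L := L - 2 * K - 1) (by linarith) (by linarith)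
      (fun i hi => by linarith [(abs_le.1 (step1 i hi)).1])
      (fun i hi => by
        have a := abs_le.1 (step1 i (by omega))
        have b := abs_le.1 (step1 (i + 1) (by omega))
        have e := step2 i hi
        unfold gromovProduct
        have f := dist_comm (c (i + 1) • p') (c i • p')
        have g : i + 1 + 1 = i + 2 := rfl
        rw [g] at b
        linarith)
    have h2 : (m : ℝ) * L ≤ (1 + δ) * (m * (L - 2 * K - 1 - 2 * (3 * K + 2))) := by
      have h3 : L ≤ (1 + δ) * (L - 2 * K - 1 - 2 * (3 * K + 2)) := by linarith
      calc (m : ℝ) * L ≤ m * ((1 + δ) * (L - 2 * K - 1 - 2 * (3 * K + 2))) := by gcongr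
        _ = _ := by ring
    have h3 : (1 + δ) * (m * (L - 2 * K - 1 - 2 * (3 * K + 2))) ≤
        (1 + δ) * (dist p' (g • p') + 2 * C) := by
      gcongr
      linarith [dist_triangle4 (c 0 • p') p' (g • p') (c m • p'), dist_comm p' (c 0 • p'),
        dist_comm (g • p') (c m • p')]
    linarith

/-- Points on `[p, u p]` are close to orbit points `w p` such that `w p'` is close to `[p', u p']`. -/
theorem exists_near_segment [Finite ι] (T T' : FreeTree ι) (p : T) (p' : T') :
    ∃ K, 0 ≤ K ∧ ∀ (u : FreeGroup ι) (z : T), Btw p z (u • p) → ∃ (w : FreeGroup ι) (q : T'),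
      dist z (w • p) ≤ K ∧ Btw p' q (u • p') ∧ dist q (w • p') ≤ K := by
  obtain ⟨K', hK', hcob⟩ := T'.exists_cobounded p'
  obtain ⟨K, hK, hKb⟩ := exists_orbit_bound T' T p' p (2 * K' + 1)
  refine ⟨max K K', hK.trans (le_max_left _ _), fun u z hz => ?_⟩
  obtain ⟨q, hq⟩ := T'.exists_subdivision p' (u • p') zero_le_one
  -- When `q i` is itself an orbit point, freeness determines its group element; the clause on `v`
  -- makes the chain run exactly from `1` to `u`.
  have h : ∀ i, ∃ w : FreeGroup ι, dist (q i) (w • p') ≤ K' ∧ ∀ v : FreeGroup ι,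
      q i = v • p' → w = v := by
    intro i
    by_cases h : ∃ v : FreeGroup ι, q i = v • p'
    · obtain ⟨v, hv⟩ := h
      refine ⟨v, by rwa [hv, dist_self], fun v' hv' => ?_⟩
      have := T'.free (v'⁻¹ * v) p' (by rw [mul_smul, ← hv, hv', inv_smul_smul])
      exact (inv_mul_eq_one.1 this).symm
    · obtain ⟨w, hw⟩ := hcob (q i)
      exact ⟨w, hw, fun v hv => (h ⟨v, hv⟩).elim⟩
  choose w hw hwv using h
  have h0 : w 0 = 1 := by
    refine hwv 0 1 ?_
    have := (hq 0).2
    rw [Nat.cast_zero, zero_mul, min_eq_left dist_nonneg, dist_eq_zero] at this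
    rw [one_smul, this]
  set m := ⌈dist p' (u • p')⌉₊
  have hm : w m = u := by
    refine hwv m u ?_
    have h1 := (hq m).2
    rw [mul_one, min_eq_right (Nat.le_ceil _)] at h1
    have h2 := (hq m).1
    unfold Btw at h2
    rw [← dist_eq_zero]
    linarith
  have hstep : ∀ i < m, dist (w i • p) (w (i + 1) • p) ≤ K := by
    intro i _
    rw [dist_smul_smul_eq]
    refine hKb _ ?_
    rw [← dist_smul_smul_eq]
    have h1 : dist (q i) (q (i + 1)) ≤ 1 := by
      rw [T'.isRTree.dist_eq_abs (hq i).1 (hq (i + 1)).1, (hq i).2, (hq (i + 1)).2]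
      refine (abs_min_sub_min_le_max _ _ _ _).trans ?_
      push_cast
      simp
    linarith [dist_triangle4 (w i • p') (q i) (q (i + 1)) (w (i + 1) • p'), hw i, hw (i + 1),
      dist_comm (q i) (w i • p')]
  obtain ⟨i, -, hi⟩ := T.isRTree.exists_dist_le_chain (fun i => w i • p) hK hstep
    (by simpa only [h0, hm, one_smul] using hz)
  exact ⟨w i, q i, hi.trans (le_max_left _ _), (hq i).1, (hw i).trans (le_max_right _ _)⟩

/-- Bounded cancellation. -/
theorem exists_gromovProduct_bound [Finite ι] (T T' : FreeTree ι) (p : T) (p' : T') (κ : ℝ) :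
    ∃ C, 0 ≤ C ∧ ∀ u v : FreeGroup ι, gromovProduct p' (u • p') (v • p') ≤ κ →
      gromovProduct p (u • p) (v • p) ≤ C := by
  obtain ⟨K, hK, hnear⟩ := exists_near_segment T T' p p'
  obtain ⟨K₁, hK₁, hb₁⟩ := exists_orbit_bound T T' p p' (2 * K)
  obtain ⟨K₂, hK₂, hb₂⟩ := exists_orbit_bound T' T p' p (K₁ + 3 * K + 2 * κ)
  refine ⟨K₂ + K, by positivity, fun u v huv => ?_⟩
  -- `z` is the branch point of `[p, u p]` and `[p, v p]`. It is shadowed in `T'` by points near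
  -- both `[p', u p']` and `[p', v p']`, which can be close to each other only near `p'`.
  obtain ⟨z, hz, hzd⟩ := T.isRTree.exists_btw p (u • p) (gromovProduct_nonneg p (u • p) (v • p))
    (gromovProduct_le_left _ _ _)
  obtain ⟨w₁, q₁, h1, h2, h3⟩ := hnear u z hz
  obtain ⟨w₂, q₂, h4, h5, h6⟩ := hnear v z (T.isRTree.btw_of_le_gromovProduct hz hzd.le)
  have h7 : dist (w₁ • p') (w₂ • p') ≤ K₁ := by
    rw [dist_smul_smul_eq]
    refine hb₁ _ ?_
    rw [← dist_smul_smul_eq]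
    linarith [dist_triangle_left (w₁ • p) (w₂ • p) z]
  have h8 : dist p (w₁ • p) ≤ K₂ := by
    refine hb₂ _ ?_
    unfold gromovProduct at huv
    unfold Btw at h2 h5
    linarith [dist_triangle4 q₁ (w₁ • p') (w₂ • p') q₂, dist_comm q₂ (w₂ • p'),
      dist_triangle4 (u • p') q₁ q₂ (v • p'), dist_comm (u • p') q₁,
      dist_triangle p' q₁ (w₁ • p'), dist_nonneg (x := p') (y := q₂)]
  linarith [dist_triangle p (w₁ • p) z, dist_comm z (w₁ • p)]

end FreeTree

/-! ### Prefixes of infinite words and compactness of `∂F` -/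

namespace Boundary

variable {ι : Type u}

theorem initial_succ (ξ : Boundary ι) (n : ℕ) :
    ξ.initial (n + 1) = FreeGroup.mk [ξ.1 0] * (shift ξ).initial n := by
  unfold initial
  rw [List.ofFn_succ, FreeGroup.mul_mk]
  rfl

theorem initial_zero (ξ : Boundary ι) : ξ.initial 0 = 1 := rfl

theorem initial_succ' (ξ : Boundary ι) (n : ℕ) :
    ξ.initial (n + 1) = ξ.initial n * FreeGroup.mk [ξ.1 n] := by
  induction n generalizing ξ with
  | zero => rw [initial_succ, initial_zero, initial_zero, one_mul, mul_one]
  | succ n ih => rw [initial_succ, ih, ← mul_assoc, ← initial_succ]; rfl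

theorem initial_congr {ξ η : Boundary ι} {n : ℕ} (h : ∀ j < n, ξ.1 j = η.1 j) :
    ξ.initial n = η.initial n := by
  unfold initial
  congr 2
  funext j
  exact h j j.2

theorem isReduced_ofFn (ξ : Boundary ι) (n : ℕ) :
    FreeGroup.IsReduced (List.ofFn fun j : Fin n => ξ.1 j) := by
  rw [FreeGroup.IsReduced, List.isChain_ofFn]
  intro i hi h
  by_contra h'
  exact ξ.2 i (Prod.ext h.symm (Bool.eq_not_of_ne fun h2 => h' h2.symm))

theorem norm_mk_of_isReduced [DecidableEq ι] {L : List (ι × Bool)} (h : FreeGroup.IsReduced L) :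
    (FreeGroup.mk L).norm = L.length := by
  rw [FreeGroup.norm, FreeGroup.toWord_mk, h.reduce_eq]

theorem norm_initial [DecidableEq ι] (ξ : Boundary ι) (n : ℕ) : (ξ.initial n).norm = n := by
  rw [initial, norm_mk_of_isReduced (isReduced_ofFn ξ n), List.length_ofFn]

theorem norm_inv_initial_mul_initial [DecidableEq ι] {ξ η : Boundary ι} (h : ξ.1 0 ≠ η.1 0)
    (i j : ℕ) : ((ξ.initial i)⁻¹ * η.initial j).norm = i + j := by
  unfold initial
  rw [FreeGroup.inv_mk, FreeGroup.mul_mk, norm_mk_of_isReduced]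
  · simp
  · rw [FreeGroup.IsReduced, List.isChain_append]
    refine ⟨?_, isReduced_ofFn η j, ?_⟩
    · rw [FreeGroup.invRev, List.isChain_reverse, List.isChain_map]
      refine (isReduced_ofFn ξ i).imp fun a b hab hba => ?_
      simp only at hba
      rw [hab hba.symm]
    · intro a ha b hb hab
      cases i with
      | zero => simp [FreeGroup.invRev] at ha
      | succ i =>
        cases j with
        | zero => simp at hb
        | succ j =>
          simp [FreeGroup.invRev, List.ofFn_succ] at ha hb
          subst ha hb
          simp only at hab ⊢
          exact (Bool.eq_not_of_ne fun h2 => h (Prod.ext hab h2.symm)).symm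

/-- At most `N` letters of the prefix of `ξ` can cancel, because the words already disagree at
position `N`. -/
theorem le_norm_inv_initial_mul_initial [DecidableEq ι] (N : ℕ) {ξ η : Boundary ι}
    (h : ξ.1 N ≠ η.1 N) (i j : ℕ) : i ≤ ((ξ.initial i)⁻¹ * η.initial j).norm + N := by
  induction N generalizing ξ η i j with
  | zero => rw [norm_inv_initial_mul_initial h]; omega
  | succ N ih =>
    by_cases h0 : ξ.1 0 = η.1 0
    · cases i with
      | zero => omega
      | succ i =>
        cases j with
        | zero => rw [initial_zero, mul_one, FreeGroup.norm_inv_eq, norm_initial]; omega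
        | succ j =>
          have := ih (ξ := shift ξ) (η := shift η) h i j
          rw [initial_succ, initial_succ, h0, mul_inv_rev, mul_assoc, inv_mul_cancel_left]
          omega
    · rw [norm_inv_initial_mul_initial h0]; omega

theorem of_smul (i : ι) (ξ : Boundary ι) : FreeGroup.of i • ξ = letterMul (i, true) ξ := by
  change (FreeGroup.lift (generatorPerm (ι := ι)) (FreeGroup.of i)) ξ = _
  rw [FreeGroup.lift_apply_of]
  rfl

theorem of_inv_smul (i : ι) (ξ : Boundary ι) :
    (FreeGroup.of i)⁻¹ • ξ = letterMul (i, false) ξ := by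
  change (FreeGroup.lift (generatorPerm (ι := ι)) (FreeGroup.of i)⁻¹) ξ = _
  rw [map_inv, FreeGroup.lift_apply_of]
  rfl

theorem mk_mul_initial (a : ι × Bool) (ξ : Boundary ι) :
    ∃ k l : ℕ, ∀ n, FreeGroup.mk [a] * ξ.initial (n + k) = (letterMul a ξ).initial (n + l) := by
  by_cases h : ξ.1 0 = (a.1, !a.2)
  · refine ⟨1, 0, fun n => ?_⟩
    rw [initial_succ, letterMul, dif_pos h, h, ← mul_assoc]
    have : FreeGroup.mk [a] * FreeGroup.mk [(a.1, !a.2)] = 1 := by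
      rw [mul_eq_one_iff_inv_eq, FreeGroup.inv_mk]
      rfl
    rw [this, one_mul, add_zero]
  · refine ⟨0, 1, fun n => ?_⟩
    rw [initial_succ, letterMul, dif_neg h]
    rfl

/-- Left multiplication changes only a finite beginning of the word; `k` and `l` absorb the
cancelled and the added letters. -/
theorem smul_initial (g : FreeGroup ι) (ξ : Boundary ι) :
    ∃ k l : ℕ, ∀ n, g * ξ.initial (n + k) = (g • ξ).initial (n + l) := by
  induction g using FreeGroup.induction_on generalizing ξ with
  | C1 => exact ⟨0, 0, fun n => by rw [one_mul, one_smul]⟩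
  | of i =>
    rw [of_smul]
    exact mk_mul_initial (i, true) ξ
  | inv_of i =>
    rw [of_inv_smul]
    exact mk_mul_initial (i, false) ξ
  | mul x y hx hy =>
    obtain ⟨k, l, h⟩ := hy ξ
    obtain ⟨k', l', h'⟩ := hx (y • ξ)
    refine ⟨k' + k, l + l', fun n => ?_⟩
    rw [mul_assoc, ← add_assoc, h, mul_smul, ← add_assoc, ← h', add_right_comm]

theorem isEmbedding_val : @IsEmbedding (Boundary ι) (ℕ → ι × Bool) _
    (@Pi.topologicalSpace ℕ (fun _ => ι × Bool) (fun _ => ⊥)) Subtype.val :=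
  @IsEmbedding.mk _ _ _ (_) _ (@IsInducing.mk _ _ _ (_) _ rfl) Subtype.val_injective

instance [Finite ι] : CompactSpace (Boundary ι) := by
  let : TopologicalSpace (ι × Bool) := ⊥
  have : DiscreteTopology (ι × Bool) := ⟨rfl⟩
  have h : IsClosedEmbedding (Subtype.val : Boundary ι → ℕ → ι × Bool) := by
    refine ⟨isEmbedding_val, ?_⟩
    rw [Subtype.range_coe_subtype, Set.ofPred_forall]
    refine isClosed_iInter fun n => ?_
    have hc : Continuous fun q : ℕ → ι × Bool => (q (n + 1), q n) :=
      (continuous_apply (n + 1)).prodMk (continuous_apply n)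
    exact (isClosed_discrete {q : (ι × Bool) × (ι × Bool) | q.1 ≠ (q.2.1, !q.2.2)}).preimage hc
  exact h.compactSpace

theorem isClopen_differ (j : ℕ) :
    IsClopen {q : Boundary ι × Boundary ι | q.1.1 j ≠ q.2.1 j} := by
  let : TopologicalSpace (ι × Bool) := ⊥
  have : DiscreteTopology (ι × Bool) := ⟨rfl⟩
  have hc : Continuous fun ξ : Boundary ι => ξ.1 j :=
    (continuous_apply j).comp isEmbedding_val.continuous
  exact (isClopen_discrete {q : (ι × Bool) × (ι × Bool) | q.1 ≠ q.2}).preimage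
    ((hc.comp continuous_fst).prodMk (hc.comp continuous_snd))

end Boundary

/-! ### Compact subsets of `∂²F` -/

namespace DoubleBoundary

variable {ι : Type u}

/-- The pairs of words which differ in one of the first `N` letters. -/
def differ (ι : Type u) (N : ℕ) : Set (DoubleBoundary ι) := {ζ | ∃ j < N, ζ.1.1.1 j ≠ ζ.1.2.1 j}

theorem isClosed_differ_prod (N : ℕ) :
    IsClosed {q : Boundary ι × Boundary ι | ∃ j < N, q.1.1 j ≠ q.2.1 j} := by
  have : {q : Boundary ι × Boundary ι | ∃ j < N, q.1.1 j ≠ q.2.1 j} =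
      ⋃ j ∈ Set.Iio N, {q : Boundary ι × Boundary ι | q.1.1 j ≠ q.2.1 j} := by
    ext q
    simp
  rw [this]
  exact (Set.finite_Iio N).isClosed_biUnion fun j _ => (Boundary.isClopen_differ j).isClosed

theorem isEmbedding_val :
    IsEmbedding fun ζ : DoubleBoundary ι => (ζ.1 : Boundary ι × Boundary ι) :=
  ⟨⟨rfl⟩, Subtype.val_injective⟩

theorem measurableSet_differ (N : ℕ) : MeasurableSet (differ ι N) :=
  have h : IsClosed (differ ι N) := (isClosed_differ_prod N).preimage isEmbedding_val.continuous
  h.measurableSet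

theorem isCompact_differ [Finite ι] (N : ℕ) : IsCompact (differ ι N) := by
  rw [isEmbedding_val.isCompact_iff]
  convert (isClosed_differ_prod (ι := ι) N).isCompact
  ext q
  constructor
  · rintro ⟨ζ, hζ, rfl⟩
    exact hζ
  · intro hq
    refine ⟨⟨q, fun h => ?_⟩, hq, rfl⟩
    obtain ⟨j, -, hj⟩ := hq
    exact hj (by rw [h])

end DoubleBoundary

/-! ### The identification of `∂F` with `∂T`, and cylinders in terms of prefixes -/

namespace FreeTree

variable {ι : Type u}

theorem dist_initial_succ_le (T : FreeTree ι) {p : T} {K : ℝ}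
    (hK : ∀ a : ι × Bool, dist p (FreeGroup.mk [a] • p) ≤ K) (ξ : Boundary ι) (n : ℕ) :
    dist (ξ.initial n • p) (ξ.initial (n + 1) • p) ≤ K := by
  rw [Boundary.initial_succ', mul_smul, dist_smul]
  exact hK _

/-- Words with a long common prefix are close at infinity in `T`, uniformly. -/
theorem exists_le_gromovProduct_initial [Finite ι] (T : FreeTree ι) (p : T) (R : ℝ) :
    ∃ N : ℕ, ∀ ξ η : Boundary ι, (∀ j < N, ξ.1 j = η.1 j) → ∀ n m, N ≤ n → N ≤ m →
      R ≤ gromovProduct p (ξ.initial n • p) (η.initial m • p) := by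
  classical
  obtain ⟨K, hK, hKa⟩ := T.exists_letter_bound p
  -- Prefixes longer than `M` move `p` farther than `R + K`. Consecutive ones, at most `K` apart,
  -- then have product at least `R`.
  obtain ⟨M, hM⟩ := ((T.discrete p (R + K)).image FreeGroup.norm).bddAbove
  have hfar : ∀ (ξ : Boundary ι) (n : ℕ), M + 1 ≤ n → R + K ≤ dist p (ξ.initial n • p) := by
    intro ξ n hn
    by_contra! h
    have := hM ⟨ξ.initial n, h.le, rfl⟩
    rw [Boundary.norm_initial] at this
    omega
  have hlt : ∀ (ξ : Boundary ι) (n m : ℕ), M + 1 ≤ n → n ≤ m →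
      R ≤ gromovProduct p (ξ.initial n • p) (ξ.initial m • p) := by
    intro ξ n m hn hnm
    rcases hnm.eq_or_lt with rfl | hnm
    · have := hfar ξ n hn
      unfold gromovProduct
      rw [dist_self]
      linarith
    · obtain ⟨k, hk, -, h⟩ :=
        T.isRTree.exists_gromovProduct_le_chain p (fun n => ξ.initial n • p) hnm
      refine le_trans ?_ h
      have h1 := hfar ξ k (by omega)
      have h2 := sub_dist_le_gromovProduct p (ξ.initial k • p) (ξ.initial (k + 1) • p)
      have h3 := T.dist_initial_succ_le hKa ξ k
      linarith
  refine ⟨M + 1, fun ξ η h n m hn hm => ?_⟩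
  refine le_trans (le_min ?_ (hlt η (M + 1) m le_rfl hm))
    (T.isRTree.min_gromovProduct_le p _ (η.initial (M + 1) • p) _)
  rw [← Boundary.initial_congr h, gromovProduct_comm]
  exact hlt ξ (M + 1) n le_rfl hn

theorem exists_le_gromovProduct [Finite ι] (T : FreeTree ι) (p x : T) (ξ : Boundary ι) (R : ℝ) :
    ∃ N : ℕ, ∀ n m, N ≤ n → N ≤ m →
      R ≤ gromovProduct x (ξ.initial n • p) (ξ.initial m • p) := by
  obtain ⟨N, hN⟩ := T.exists_le_gromovProduct_initial p (R + dist p x)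
  refine ⟨N, fun n m hn hm => ?_⟩
  linarith [hN ξ ξ (fun _ _ => rfl) n m hn hm,
    gromovProduct_le_add_dist p x (ξ.initial n • p) (ξ.initial m • p)]

/-- Distinct points of `∂F` are not identified in `∂T`. -/
theorem exists_gromovProduct_le_of_ne [Finite ι] (T : FreeTree ι) (p : T) {ξ η : Boundary ι}
    (h : ξ ≠ η) :
    ∃ R : ℝ, ∀ n m, gromovProduct p (ξ.initial n • p) (η.initial m • p) ≤ R := by
  classical
  obtain ⟨N, hN⟩ : ∃ N, ξ.1 N ≠ η.1 N := by
    by_contra! h'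
    exact h (Subtype.ext (funext h'))
  obtain ⟨K, hK, hKa⟩ := T.exists_letter_bound p
  obtain ⟨M, hM⟩ := ((T.discrete p (2 * K)).image FreeGroup.norm).bddAbove
  refine ⟨(M + N : ℕ) * K + K, fun n m => ?_⟩
  obtain ⟨z, hz, hzd⟩ := T.isRTree.exists_btw p (ξ.initial n • p)
    (gromovProduct_nonneg p (ξ.initial n • p) (η.initial m • p)) (gromovProduct_le_left _ _ _)
  have hz' := T.isRTree.btw_of_le_gromovProduct hz hzd.le
  have hnear : ∀ (ξ : Boundary ι) (n : ℕ), Btw p z (ξ.initial n • p) →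
      ∃ i, dist z (ξ.initial i • p) ≤ K := by
    intro ξ n h
    obtain ⟨i, -, hi⟩ := T.isRTree.exists_dist_le_chain (fun n => ξ.initial n • p) (m := n) hK
      (fun i _ => T.dist_initial_succ_le hKa ξ i) (by simpa only [Boundary.initial_zero, one_smul])
    exact ⟨i, hi⟩
  obtain ⟨i, hi⟩ := hnear ξ n hz
  obtain ⟨j, hj⟩ := hnear η m hz'
  -- Both prefixes are near `z`, so their quotient is one of finitely many elements. Its norm bounds
  -- `i`, and hence bounds `d(p, z)`.
  have h1 : dist p (((ξ.initial i)⁻¹ * η.initial j) • p) ≤ 2 * K := by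
    rw [← dist_smul_smul_eq]
    linarith [dist_triangle_left (ξ.initial i • p) (η.initial j • p) z]
  have h2 := hM ⟨_, h1, rfl⟩
  have h3 := Boundary.le_norm_inv_initial_mul_initial N hN i j
  have h4 : ∀ i : ℕ, dist p (ξ.initial i • p) ≤ i * K := by
    intro i
    induction i with
    | zero => simp [Boundary.initial_zero]
    | succ i ih =>
      push_cast
      linarith [T.dist_initial_succ_le hKa ξ i,
        dist_triangle p (ξ.initial i • p) (ξ.initial (i + 1) • p)]
  have h5 : (i : ℝ) * K ≤ (M + N : ℕ) * K := by
    gcongr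
    omega
  linarith [h4 i, dist_triangle p (ξ.initial i • p) z, dist_comm z (ξ.initial i • p)]

/-- Moving the observation point or the base of the orbit changes the Gromov product boundedly, so
one independent choice of each suffices. -/
theorem endsAt_iff (T : FreeTree ι) (p x : T) (γ : ℝ → T) (ξ : Boundary ι) :
    T.EndsAt γ ξ ↔ ∀ R : ℝ, ∃ (t₀ : ℝ) (N : ℕ), ∀ t n, t₀ ≤ t → N ≤ n →
      R ≤ gromovProduct x (γ t) (ξ.initial n • p) := by
  have key : ∀ q : T, Tendsto (fun a : ℝ × ℕ => gromovProduct q (γ a.1) (ξ.initial a.2 • q))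
      (atTop ×ˢ atTop) atTop ↔ ∀ R : ℝ, ∃ (t₀ : ℝ) (N : ℕ), ∀ t n, t₀ ≤ t → N ≤ n →
      R ≤ gromovProduct q (γ t) (ξ.initial n • q) := by
    intro q
    rw [prod_atTop_atTop_eq, tendsto_atTop]
    simp only [eventually_atTop, Prod.forall, Prod.exists, Prod.mk_le_mk, and_imp]
  have change : ∀ (q q' x x' : T) (t : ℝ) (n : ℕ), gromovProduct x (γ t) (ξ.initial n • q) ≤
      gromovProduct x' (γ t) (ξ.initial n • q') + (dist x x' + dist q q') := by
    intro q q' x x' t n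
    have h1 := gromovProduct_le_add_dist x x' (γ t) (ξ.initial n • q)
    have h2 := gromovProduct_le_add_dist_right x' (γ t) (ξ.initial n • q) (ξ.initial n • q')
    rw [dist_smul] at h2
    linarith
  constructor
  · intro h R
    obtain ⟨t₀, N, hN⟩ := (key p).1 (h p) (R + (dist p x + dist p p))
    exact ⟨t₀, N, fun t n ht hn => by linarith [hN t n ht hn, change p p p x t n]⟩
  · intro h q
    rw [key]
    intro R
    obtain ⟨t₀, N, hN⟩ := h (R + (dist x q + dist p q))
    exact ⟨t₀, N, fun t n ht hn => by linarith [hN t n ht hn, change p q x q t n]⟩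

/-- The segments `[x, b n]` stabilize on every bounded initial piece. Values at negative times are
placeholders. -/
theorem exists_ray (T : FreeTree ι) (x : T) (b : ℕ → T)
    (hb : ∀ R : ℝ, ∃ N : ℕ, ∀ n m, N ≤ n → N ≤ m → R ≤ gromovProduct x (b n) (b m)) :
    ∃ r : ℝ → T, ∀ t, 0 ≤ t → dist x (r t) = t ∧ ∃ N, ∀ n, N ≤ n → Btw x (r t) (b n) := by
  have h : ∀ t : ℝ, ∃ z, 0 ≤ t → dist x z = t ∧ ∃ N, ∀ n, N ≤ n → Btw x z (b n) := by
    intro t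
    by_cases ht : 0 ≤ t
    · obtain ⟨N, hN⟩ := hb t
      obtain ⟨z, hz, hzt⟩ := T.isRTree.exists_btw x (b N) ht
        ((hN N N le_rfl le_rfl).trans (gromovProduct_le_left _ _ _))
      exact ⟨z, fun _ => ⟨hzt, N, fun n hn =>
        T.isRTree.btw_of_le_gromovProduct hz (hzt.trans_le (hN N n le_rfl hn))⟩⟩
    · exact ⟨x, fun h => (ht h).elim⟩
  choose r hr using h
  exact ⟨r, hr⟩

/-- Agreement is required only at positive times, because a line glued from two rays takes its value
at `0` from just one of them. -/
theorem endsAt_of_ray [Finite ι] (T : FreeTree ι) (p x : T) (ξ : Boundary ι) {r γ : ℝ → T}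
    (hr : ∀ t, 0 ≤ t → dist x (r t) = t ∧ ∃ N, ∀ n, N ≤ n → Btw x (r t) (ξ.initial n • p))
    (hγ : ∀ t, 0 < t → γ t = r t) : T.EndsAt γ ξ := by
  rw [T.endsAt_iff p x]
  intro R
  have hR : 0 < max R 1 := lt_max_of_lt_right one_pos
  obtain ⟨hd, N, hN⟩ := hr (max R 1) hR.le
  refine ⟨max R 1, N, fun t n ht hn => ?_⟩
  rw [hγ t (hR.trans_le ht)]
  obtain ⟨hd', N', hN'⟩ := hr t (hR.le.trans ht)
  have h1 : Btw x (r (max R 1)) (r t) :=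
    T.isRTree.btw_of_le (hN _ (le_max_left N N')) (hN' _ (le_max_right N N')) (by rwa [hd, hd'])
  calc R ≤ max R 1 := le_max_left _ _
    _ = dist x (r (max R 1)) := hd.symm
    _ ≤ _ := h1.dist_le_gromovProduct (hN n hn)

/-- A pair of boundary points belongs to a cylinder iff `[x, y]` eventually lies on the geodesics
between the approximating orbit points. -/
theorem mem_cylinder_iff [Finite ι] (T : FreeTree ι) (p : T) {x y : T} (hxy : x ≠ y)
    (ζ : DoubleBoundary ι) :
    ζ ∈ T.cylinder x y ↔ ∃ N : ℕ, ∀ n m, N ≤ n → N ≤ m →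
      Btw (ζ.1.1.initial n • p) x y ∧ Btw x y (ζ.1.2.initial m • p) := by
  have hT := T.isRTree
  constructor
  · rintro ⟨γ, hγ, h0, h1, h2, h3⟩
    rw [T.endsAt_iff p y] at h2
    rw [T.endsAt_iff p x] at h3
    obtain ⟨t₁, N₁, hN₁⟩ := h2 (dist x y)
    obtain ⟨t₂, N₂, hN₂⟩ := h3 (dist x y)
    have hd : ∀ s t, dist (γ s) (γ t) = |s - t| := fun s t => by rw [hγ.dist_eq, Real.dist_eq]
    have hpos : 0 ≤ dist x y := dist_nonneg
    have hd' : ∀ s t, s ≤ t → dist (γ s) (γ t) = t - s := fun s t hst => by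
      rw [hd, abs_sub_comm, abs_of_nonneg (by linarith)]
    refine ⟨max N₁ N₂, fun n m hn hm => ⟨?_, ?_⟩⟩
    · have a := hN₁ (max t₁ 0) n (le_max_left _ _) ((le_max_left _ _).trans hn)
      refine (hT.btw_of_le_gromovProduct (u := γ (-max t₁ 0)) ?_ ?_).symm
      · have := le_max_right t₁ 0
        have e1 : dist (γ (-max t₁ 0)) x = 0 - -max t₁ 0 := by
          nth_rw 1 [← h0]
          exact hd' _ _ (by linarith)
        have e2 : dist (γ (-max t₁ 0)) y = dist x y - -max t₁ 0 := by
          nth_rw 1 [← h1]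
          exact hd' _ _ (by linarith)
        unfold Btw
        linarith [dist_comm (γ (-max t₁ 0)) x, dist_comm (γ (-max t₁ 0)) y, dist_comm x y]
      · rw [dist_comm]
        exact a
    · have a := hN₂ (max t₂ (dist x y)) m (le_max_left _ _) ((le_max_right _ _).trans hm)
      refine hT.btw_of_le_gromovProduct (u := γ (max t₂ (dist x y))) ?_ a
      have := le_max_right t₂ (dist x y)
      have e1 : dist y (γ (max t₂ (dist x y))) = max t₂ (dist x y) - dist x y := by
        nth_rw 1 [← h1]
        exact hd' _ _ this
      have e2 : dist x (γ (max t₂ (dist x y))) = max t₂ (dist x y) - 0 := by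
        nth_rw 1 [← h0]
        exact hd' _ _ (hpos.trans this)
      unfold Btw
      linarith
  · rintro ⟨N, hN⟩
    -- The rays from `x` to the two boundary points leave in opposite directions, so together they
    -- form a line.
    have hov : ∀ n m, N ≤ n → N ≤ m →
        Btw (ζ.1.1.initial n • p) x (ζ.1.2.initial m • p) := by
      intro n m hn hm
      obtain ⟨h1, h2⟩ := hN n m hn hm
      have := hT.dist_eq_of_overlap hxy h1 h2
      unfold Btw at *
      linarith
    obtain ⟨r, hr⟩ := T.exists_ray x _ (T.exists_le_gromovProduct p x ζ.1.2)
    obtain ⟨l, hl⟩ := T.exists_ray x _ (T.exists_le_gromovProduct p x ζ.1.1)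
    let γ : ℝ → T := fun t => if 0 ≤ t then r t else l (-t)
    have hγr : ∀ t, 0 ≤ t → γ t = r t := fun t ht => if_pos ht
    have hγl : ∀ t, t < 0 → γ t = l (-t) := fun t ht => if_neg (not_le.2 ht)
    have hlr : ∀ s t, 0 ≤ s → 0 ≤ t → dist (l s) (r t) = s + t := by
      intro s t hs ht
      obtain ⟨hs', N₁, hN₁⟩ := hl s hs
      obtain ⟨ht', N₂, hN₂⟩ := hr t ht
      have h1 := hN₁ (max N N₁) (le_max_right _ _)
      have h2 := hN₂ (max N N₂) (le_max_right _ _)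
      have h3 := (hov (max N N₁) (max N N₂) (le_max_left _ _) (le_max_left _ _)).trans_left h1.symm
      have h4 := (h3.symm.trans_left h2.symm).symm
      unfold Btw at h4
      rw [← h4, dist_comm, hs', ht']
    have hll : ∀ s t, 0 ≤ s → 0 ≤ t → dist (l s) (l t) = |s - t| := by
      intro s t hs ht
      obtain ⟨hs', N₁, hN₁⟩ := hl s hs
      obtain ⟨ht', N₂, hN₂⟩ := hl t ht
      rw [hT.dist_eq_abs (hN₁ (max N₁ N₂) (le_max_left _ _)) (hN₂ _ (le_max_right _ _)), hs', ht']
    have hrr : ∀ s t, 0 ≤ s → 0 ≤ t → dist (r s) (r t) = |s - t| := by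
      intro s t hs ht
      obtain ⟨hs', N₁, hN₁⟩ := hr s hs
      obtain ⟨ht', N₂, hN₂⟩ := hr t ht
      rw [hT.dist_eq_abs (hN₁ (max N₁ N₂) (le_max_left _ _)) (hN₂ _ (le_max_right _ _)), hs', ht']
    refine ⟨γ, ?_, ?_, ?_, ?_, ?_⟩
    · refine Isometry.of_dist_eq fun s t => ?_
      rw [Real.dist_eq]
      rcases lt_or_ge s 0 with hs | hs <;> rcases lt_or_ge t 0 with ht | ht
      · rw [hγl s hs, hγl t ht, hll _ _ (by linarith) (by linarith), abs_sub_comm]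
        congr 1
        ring
      · rw [hγl s hs, hγr t ht, hlr _ _ (by linarith) ht, abs_sub_comm, abs_of_nonneg] <;>
          linarith
      · rw [hγr s hs, hγl t ht, dist_comm, hlr _ _ (by linarith) hs, abs_of_nonneg] <;>
          linarith
      · rw [hγr s hs, hγr t ht, hrr _ _ hs ht]
    · rw [hγr 0 le_rfl]
      exact (dist_eq_zero.1 (hr 0 le_rfl).1).symm
    · rw [hγr _ dist_nonneg]
      obtain ⟨h1, N', hN'⟩ := hr (dist x y) dist_nonneg
      exact hT.btw_eq (hN' (max N N') (le_max_right _ _))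
        (hN N (max N N') le_rfl (le_max_left _ _)).2 h1
    · refine T.endsAt_of_ray p x ζ.1.1 hl fun t ht => ?_
      rw [hγl (-t) (by linarith), neg_neg]
    · exact T.endsAt_of_ray p x ζ.1.2 hr fun t ht => hγr t ht.le

/-! ### Comparison, mass and subdivision of cylinders -/

/-- A cylinder of one tree is contained in a cylinder of another tree of coarsely the same
length. -/
theorem exists_cylinder_subset [Finite ι] (T T' : FreeTree ι) (p : T) (p' : T') :
    ∃ C, 0 ≤ C ∧ ∀ x' y' : T', x' ≠ y' → ∃ g h : FreeGroup ι,
      dist x' (g • p') ≤ C ∧ dist y' (h • p') ≤ C ∧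
      (2 * C < dist (g • p) (h • p) → ∃ x y : T, dist x y = dist (g • p) (h • p) - 2 * C ∧
        T'.cylinder x' y' ⊆ T.cylinder x y) := by
  have hT := T.isRTree
  obtain ⟨K, hK, hcob⟩ := T'.exists_cobounded p'
  obtain ⟨C₀, hC₀, hb₀⟩ := exists_gromovProduct_bound T T' p p' (2 * K)
  obtain ⟨C, hKC, hC₀C⟩ : ∃ C, K ≤ C ∧ C₀ ≤ C := ⟨max K C₀, le_max_left _ _, le_max_right _ _⟩
  have hC : 0 ≤ C := hK.trans hKC
  -- Bounded cancellation, translated to the base point `g p`. Geodesics crossing `[x', y']` in `T'`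
  -- therefore follow `[g p, h p]` in `T` except within `C` of its ends, which are trimmed off.
  have hb : ∀ (g u v : FreeGroup ι) (x y : T'), dist x (g • p') ≤ K → dist y (v • p') ≤ K →
      Btw (u • p') x y → gromovProduct (g • p) (u • p) (v • p) ≤ C := by
    intro g u v x y hx hy h
    have h1 := btw_iff_gromovProduct_eq_zero.1 h
    have h2 := gromovProduct_le_add_dist (g • p') x (u • p') (v • p')
    have h3 := gromovProduct_le_add_dist_right x (u • p') (v • p') y
    have h4 := hb₀ (g⁻¹ * u) (g⁻¹ * v) (by
      rw [← gromovProduct_smul g, smul_smul, smul_smul, mul_inv_cancel_left, mul_inv_cancel_left]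
      linarith [dist_comm (g • p') x, dist_comm (v • p') y])
    rw [← gromovProduct_smul g, smul_smul, smul_smul, mul_inv_cancel_left,
      mul_inv_cancel_left] at h4
    exact h4.trans hC₀C
  refine ⟨C, hC, fun x' y' hxy' => ?_⟩
  obtain ⟨g, hg⟩ := hcob x'
  obtain ⟨h, hh⟩ := hcob y'
  refine ⟨g, h, hg.trans hKC, hh.trans hKC, fun hgh => ?_⟩
  obtain ⟨x, hx, hxd⟩ := hT.exists_btw (g • p) (h • p) hC (by linarith)
  obtain ⟨y, hy, hyd⟩ := hT.exists_btw (h • p) (g • p) hC (by linarith [dist_comm (g • p) (h • p)])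
  have hyd' : dist (g • p) y = dist (g • p) (h • p) - C := by
    have := hy.symm
    unfold Btw at this
    linarith [dist_comm (h • p) y]
  have hgx : Btw (g • p) x y := hT.btw_of_le hx hy.symm (by linarith)
  have hxyd : dist x y = dist (g • p) (h • p) - 2 * C := by
    unfold Btw at hgx
    linarith
  have hxy : x ≠ y := dist_pos.1 (by linarith)
  refine ⟨x, y, hxyd, fun ζ hζ => ?_⟩
  obtain ⟨N, hN⟩ := (T'.mem_cylinder_iff p' hxy' ζ).1 hζ
  refine (T.mem_cylinder_iff p hxy ζ).2 ⟨N, fun n m hn hm => ?_⟩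
  obtain ⟨h1, h2⟩ := hN n m hn hm
  have h3 := hb g _ h x' y' hg hh h1
  have h4 := hb h _ g y' x' hh hg h2.symm
  rw [gromovProduct_comm] at h3 h4
  have h5 : Btw (ζ.1.1.initial n • p) x (h • p) :=
    hT.btw_of_gromovProduct_le hx (h3.trans hxd.ge)
  have h6 : Btw (ζ.1.2.initial m • p) y (g • p) :=
    hT.btw_of_gromovProduct_le hy (h4.trans hyd.ge)
  have h7 : Btw x y (h • p) := hy.symm.trans_left hgx
  have h8 : Btw y x (g • p) := hgx.symm
  exact ⟨(h5.symm.trans_left h7.symm).symm, (h6.symm.trans_left h8.symm)⟩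

/-- The measures of all nondegenerate cylinders of a tree are uniformly bounded. -/
theorem exists_measure_cylinder_le [Finite ι] (T : FreeTree ι) (μ : GeodesicCurrent ι) :
    ∃ C : ENNReal, C ≠ ⊤ ∧ ∀ x y : T, x ≠ y → μ.measure (T.cylinder x y) ≤ C := by
  obtain ⟨p⟩ := T.isRTree.nonempty
  obtain ⟨K, hK, hcob⟩ := T.exists_cobounded p
  obtain ⟨N, hN⟩ := T.exists_le_gromovProduct_initial p (K + 1)
  have := μ.finiteOnCompacts
  have := μ.invariant
  refine ⟨μ.measure (DoubleBoundary.differ ι N),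
    (DoubleBoundary.isCompact_differ N).measure_lt_top.ne, fun x y hxy => ?_⟩
  obtain ⟨g, hg⟩ := hcob x
  rw [← SMulInvariantMeasure.measure_preimage_smul g⁻¹ (DoubleBoundary.measurableSet_differ N)]
  -- If the translated words agreed in `N` letters, their product at `g p` would be at least `K +
  -- 1`; but the geodesic joining them passes through `x`, at distance at most `K` from `g p`.
  refine measure_mono fun ζ hζ => ?_
  by_contra hcon
  have hag : ∀ j < N, (g⁻¹ • ζ.1.1).1 j = (g⁻¹ • ζ.1.2).1 j := by
    intro j hj
    by_contra h
    exact hcon ⟨j, hj, h⟩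
  obtain ⟨M, hM⟩ := (T.mem_cylinder_iff p hxy ζ).1 hζ
  obtain ⟨k, l, hkl⟩ := Boundary.smul_initial g⁻¹ ζ.1.1
  obtain ⟨k', l', hkl'⟩ := Boundary.smul_initial g⁻¹ ζ.1.2
  have h1 := hN _ _ hag (M + N + l) (M + N + l') (by omega) (by omega)
  rw [← hkl, ← hkl', ← gromovProduct_smul g, smul_smul, smul_smul, mul_inv_cancel_left,
    mul_inv_cancel_left] at h1
  obtain ⟨h2, h3⟩ := hM (M + N + k) (M + N + k') (by omega) (by omega)
  have h4 := T.isRTree.dist_eq_of_overlap hxy h2 h3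
  have h5 := gromovProduct_le_add_dist (g • p) x (ζ.1.1.initial (M + N + k) • p)
    (ζ.1.2.initial (M + N + k') • p)
  have h6 : gromovProduct x (ζ.1.1.initial (M + N + k) • p)
      (ζ.1.2.initial (M + N + k') • p) = 0 := by
    refine btw_iff_gromovProduct_eq_zero.1 ?_
    unfold Btw at *
    linarith
  linarith [dist_comm x (g • p)]

/-- A nonzero current charges some nondegenerate cylinder. -/
theorem exists_measure_cylinder_ne_zero [Finite ι] (T : FreeTree ι) (μ : GeodesicCurrent ι)
    (hμ : μ.measure ≠ 0) :
    ∃ x y : T, x ≠ y ∧ μ.measure (T.cylinder x y) ≠ 0 := by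
  obtain ⟨p⟩ := T.isRTree.nonempty
  have hT := T.isRTree
  by_contra! hcon
  refine hμ (Measure.measure_univ_eq_zero.1 ?_)
  -- In `S (h, R)` the two ends separate before distance `R`, while the second follows `[p, h p]` up
  -- to `R + 1`. All these lines cross the piece of `[p, h p]` between these distances.
  let S : FreeGroup ι × ℕ → Set (DoubleBoundary ι) := fun k =>
    {ζ | ∃ N : ℕ, ∀ n m, N ≤ n → N ≤ m →
      gromovProduct p (ζ.1.1.initial n • p) (ζ.1.2.initial m • p) ≤ k.2 ∧
      k.2 + 1 ≤ gromovProduct p (k.1 • p) (ζ.1.2.initial m • p)}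
  have hS : Set.univ ⊆ ⋃ k, S k := by
    intro ζ _
    obtain ⟨R, hR⟩ := T.exists_gromovProduct_le_of_ne p ζ.2
    obtain ⟨N, hN⟩ := T.exists_le_gromovProduct p p ζ.1.2 (⌈R⌉₊ + 1)
    exact Set.mem_iUnion.2 ⟨(ζ.1.2.initial N, ⌈R⌉₊), N, fun n m _ hm =>
      ⟨(hR n m).trans (Nat.le_ceil R), hN N m le_rfl hm⟩⟩
  have : Countable (FreeGroup ι) := Quot.mk_surjective.countable
  refine measure_mono_null hS (measure_iUnion_null fun k => ?_)
  obtain ⟨h, R⟩ := k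
  by_cases hR : (R : ℝ) + 1 ≤ dist p (h • p)
  · obtain ⟨x, hx, hxd⟩ := hT.exists_btw p (h • p) (t := R) (by positivity) (by linarith)
    obtain ⟨y, hy, hyd⟩ := hT.exists_btw p (h • p) (t := R + 1) (by positivity) hR
    have hxy : Btw p x y := hT.btw_of_le hx hy (by linarith)
    have hne : x ≠ y := by
      rintro rfl
      linarith
    refine measure_mono_null (fun ζ hζ => ?_) (hcon x y hne)
    obtain ⟨N, hN⟩ := hζ
    refine (T.mem_cylinder_iff p hne ζ).2 ⟨N, fun n m hn hm => ?_⟩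
    obtain ⟨h1, h2⟩ := hN n m hn hm
    have h3 : Btw p y (ζ.1.2.initial m • p) := hT.btw_of_le_gromovProduct hy (hyd.trans_le h2)
    have h4 : Btw x y (ζ.1.2.initial m • p) := h3.trans_left hxy
    rw [gromovProduct_comm] at h1
    have h5 : Btw (ζ.1.1.initial n • p) x (ζ.1.2.initial m • p) :=
      hT.btw_of_gromovProduct_le (h3.trans hxy) (h1.trans hxd.ge)
    exact ⟨(h5.symm.trans_left h4.symm).symm, h4⟩
  · convert measure_empty (μ := μ.measure)
    rw [Set.eq_empty_iff_forall_notMem]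
    rintro ζ ⟨N, hN⟩
    exact hR ((hN N N le_rfl le_rfl).2.trans (gromovProduct_le_left _ _ _))

/-- Every cylinder is covered by a bounded number of cylinders over extended segments. -/
theorem exists_cylinder_subset_biUnion [Finite ι] (T : FreeTree ι) :
    ∃ N : ℕ, ∀ x y : T, x ≠ y → ∃ S : Finset T, S.card ≤ N ∧
      (∀ z ∈ S, dist x z = dist x y + 1) ∧ T.cylinder x y ⊆ ⋃ z ∈ S, T.cylinder x z := by
  classical
  obtain ⟨p⟩ := T.isRTree.nonempty
  have hT := T.isRTree
  obtain ⟨K, hK, hcob⟩ := T.exists_cobounded p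
  let B := (T.discrete p (1 + 3 * K)).toFinset
  refine ⟨B.card, fun x y hxy => ?_⟩
  obtain ⟨f, hf⟩ := hcob y
  have hY : ∀ g : FreeGroup ι, ∃ z, dist x y + 1 ≤ dist x (g • p) →
      Btw x z (g • p) ∧ dist x z = dist x y + 1 := by
    intro g
    by_cases hg : dist x y + 1 ≤ dist x (g • p)
    · obtain ⟨z, hz⟩ := hT.exists_btw x (g • p) (by positivity) hg
      exact ⟨z, fun _ => hz⟩
    · exact ⟨x, fun h => (hg h).elim⟩
  choose Y hY using hY
  refine ⟨(B.filter fun b => dist x y + 1 ≤ dist x ((f * b) • p)).image fun b => Y (f * b),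
    Finset.card_image_le.trans (Finset.card_filter_le _ _), ?_, fun ζ hζ => ?_⟩
  · intro z hz
    obtain ⟨b, hb, rfl⟩ := Finset.mem_image.1 hz
    exact (hY _ (Finset.mem_filter.1 hb).2).2
  · obtain ⟨N, hN⟩ := (T.mem_cylinder_iff p hxy ζ).1 hζ
    obtain ⟨r, hr⟩ := T.exists_ray x _ (T.exists_le_gromovProduct p x ζ.1.2)
    -- The extra `K` lets `[x, g p]`, with `g p` within `K` of `z`, still follow the ray up to
    -- distance `dist x y + 1`.
    obtain ⟨hzd, M, hM⟩ := hr (dist x y + (1 + K)) (by positivity)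
    set z := r (dist x y + (1 + K))
    obtain ⟨g, hg⟩ := hcob z
    have hyz : Btw x y z := hT.btw_of_le (hN N (max N M) le_rfl (le_max_left _ _)).2
      (hM _ (le_max_right _ _)) (by linarith)
    have hgf : dist p ((f⁻¹ * g) • p) ≤ 1 + 3 * K := by
      rw [← dist_smul_smul_eq]
      unfold Btw at hyz
      linarith [dist_triangle4 (f • p) y z (g • p), dist_comm y (f • p)]
    have hxg : ∀ m, M ≤ m → dist x y + 1 ≤
        gromovProduct x (g • p) (ζ.1.2.initial m • p) := by
      intro m hm
      have h1 : Btw x z z := by simp [Btw]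
      have h2 := h1.dist_le_gromovProduct (hM m hm)
      have h3 := gromovProduct_le_add_dist_left x z (g • p) (ζ.1.2.initial m • p)
      linarith
    have hxg' : dist x y + 1 ≤ dist x (g • p) :=
      (hxg M le_rfl).trans (gromovProduct_le_left _ _ _)
    obtain ⟨h1, h2⟩ := hY g hxg'
    simp only [Set.mem_iUnion]
    refine ⟨Y g, Finset.mem_image.2 ⟨f⁻¹ * g, Finset.mem_filter.2 ⟨?_, ?_⟩, ?_⟩, ?_⟩
    · simpa [B] using hgf
    · rwa [mul_inv_cancel_left]
    · rw [mul_inv_cancel_left]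
    · have hne : x ≠ Y g := by
        intro h
        rw [← h, dist_self] at h2
        linarith [dist_nonneg (x := x) (y := y)]
      refine (T.mem_cylinder_iff p hne ζ).2 ⟨max N M, fun n m hn hm => ?_⟩
      obtain ⟨h3, h4⟩ := hN n m ((le_max_left _ _).trans hn) ((le_max_left _ _).trans hm)
      have h5 : Btw x (Y g) (ζ.1.2.initial m • p) :=
        hT.btw_of_le_gromovProduct h1 (h2.trans_le (hxg m ((le_max_right _ _).trans hm)))
      have h6 := hT.dist_eq_of_overlap hxy h3 h4
      have h7 : Btw (ζ.1.1.initial n • p) x (ζ.1.2.initial m • p) := by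
        unfold Btw at *
        linarith
      exact ⟨(h7.symm.trans_left h5.symm).symm, h5⟩

/-! ### Heavy cylinders: finiteness and comparison of entropies -/

/-- There are arbitrarily long segments whose cylinders have measure at least `exp (-s d(x, y))`. -/
def HasHeavyCylinders (T : FreeTree ι) (μ : GeodesicCurrent ι) (s : ℝ) : Prop :=
  ∀ D : ℝ, ∃ x y : T, D ≤ dist x y ∧
    ENNReal.ofReal (Real.exp (-(s * dist x y))) ≤ μ.measure (T.cylinder x y)

/-- This includes `m = 0`, where the left side is `⊤`: null cylinders never count as heavy. -/
theorem neg_log_div_le_iff {m : ENNReal} {d s : ℝ} (hd : 0 < d) :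
    -(ENNReal.log m) / (d : EReal) ≤ s ↔ ENNReal.ofReal (Real.exp (-(s * d))) ≤ m := by
  rw [EReal.div_le_iff_le_mul (by exact_mod_cast hd) (EReal.coe_ne_top d), EReal.neg_le,
    ← ENNReal.log_strictMono.le_iff_le, ← EReal.exp_coe, EReal.log_exp, mul_comm (d : EReal)]
  norm_cast

theorem frequently_comap_dist_iff (T : FreeTree ι) {P : T × T → Prop} :
    (∃ᶠ q in comap (fun q : T × T => dist q.1 q.2) atTop, P q) ↔
      ∀ D : ℝ, ∃ x y : T, D ≤ dist x y ∧ P (x, y) := by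
  rw [frequently_comap, frequently_atTop]
  refine forall_congr' fun D => ?_
  constructor
  · rintro ⟨_, hb, ⟨x, y⟩, rfl, h⟩
    exact ⟨x, y, hb, h⟩
  · rintro ⟨x, y, hD, h⟩
    exact ⟨_, hD, (x, y), rfl, h⟩

theorem hasHeavyCylinders_of_lt {T : FreeTree ι} {μ : GeodesicCurrent ι} {s : ℝ}
    (h : T.geometricEntropy μ < s) : T.HasHeavyCylinders μ s := by
  have h1 := T.frequently_comap_dist_iff.1 (frequently_lt_of_liminf_lt (by isBoundedDefault) h)
  intro D
  obtain ⟨x, y, hD, hxy⟩ := h1 (max D 1)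
  exact ⟨x, y, (le_max_left _ _).trans hD,
    (neg_log_div_le_iff (one_pos.trans_le ((le_max_right _ _).trans hD))).1 hxy.le⟩

theorem HasHeavyCylinders.geometricEntropy_le {T : FreeTree ι} {μ : GeodesicCurrent ι} {s : ℝ}
    (h : T.HasHeavyCylinders μ s) : T.geometricEntropy μ ≤ s := by
  refine liminf_le_of_frequently_le' (T.frequently_comap_dist_iff.2 fun D => ?_)
  obtain ⟨x, y, hD, hxy⟩ := h (max D 1)
  exact ⟨x, y, (le_max_left _ _).trans hD,
    (neg_log_div_le_iff (one_pos.trans_le ((le_max_right _ _).trans hD))).2 hxy⟩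

theorem HasHeavyCylinders.nonneg [Finite ι] {T : FreeTree ι} {μ : GeodesicCurrent ι} {s : ℝ}
    (h : T.HasHeavyCylinders μ s) : 0 ≤ s := by
  obtain ⟨C, hC, hCb⟩ := T.exists_measure_cylinder_le μ
  by_contra! hs
  obtain ⟨x, y, hD, hxy⟩ := h (max (C.toReal / -s) 1)
  have hpos : 0 < dist x y := one_pos.trans_le ((le_max_right _ _).trans hD)
  have h1 := (ENNReal.ofReal_le_iff_le_toReal hC).1 (hxy.trans (hCb x y (dist_pos.1 hpos)))
  have h2 := (le_max_left _ _).trans hD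
  rw [div_le_iff₀ (by linarith)] at h2
  linarith [Real.add_one_le_exp (-(s * dist x y))]

theorem exists_hasHeavyCylinders [Finite ι] (T : FreeTree ι) (μ : GeodesicCurrent ι)
    (hμ : μ.measure ≠ 0) : ∃ s, T.HasHeavyCylinders μ s := by
  obtain ⟨x, y, hxy, hm⟩ := T.exists_measure_cylinder_ne_zero μ hμ
  obtain ⟨C, hC, hCb⟩ := T.exists_measure_cylinder_le μ
  obtain ⟨N, hN⟩ := T.exists_cylinder_subset_biUnion
  have hd : 0 < dist x y := dist_pos.2 hxy
  set c := μ.measure (T.cylinder x y)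
  have hc : 0 < c.toReal := ENNReal.toReal_pos hm (ne_top_of_le_ne_top hC (hCb x y hxy))
  have key : ∀ n : ℕ, ∃ z, dist x z = dist x y + n ∧
      c ≤ (N : ENNReal) ^ n * μ.measure (T.cylinder x z) := by
    intro n
    induction n with
    | zero => exact ⟨y, by simp, by simp [c]⟩
    | succ n ih =>
      obtain ⟨z, hz, hcz⟩ := ih
      obtain ⟨S, hS, hSd, hSc⟩ := hN x z (dist_pos.1 (hz ▸ by positivity))
      have h1 : μ.measure (T.cylinder x z) ≤ ∑ w ∈ S, μ.measure (T.cylinder x w) :=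
        (measure_mono hSc).trans (measure_biUnion_finset_le _ _)
      have hne : S.Nonempty := by
        by_contra hne
        rw [Finset.not_nonempty_iff_eq_empty.1 hne, Finset.sum_empty, nonpos_iff_eq_zero] at h1
        rw [h1, mul_zero, nonpos_iff_eq_zero] at hcz
        exact hm hcz
      obtain ⟨w, hw, hmax⟩ :=
        S.exists_max_image (fun w => μ.measure (T.cylinder x w)) hne
      refine ⟨w, by rw [hSd w hw, hz]; push_cast; ring, ?_⟩
      have h2 := S.sum_le_card_nsmul _ _ hmax
      rw [nsmul_eq_mul] at h2
      calc c ≤ (N : ENNReal) ^ n * μ.measure (T.cylinder x z) := hcz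
        _ ≤ (N : ENNReal) ^ n * (N * μ.measure (T.cylinder x w)) := by
          gcongr
          refine h1.trans (h2.trans ?_)
          gcongr
        _ = _ := by ring
  -- The rate `N` absorbs the loss, as `N ^ n ≤ exp (N * n)`. The rate `a` absorbs the initial mass
  -- over the initial length, as `1 / c = a * dist x y ≤ exp (a * dist x y)`.
  set a := 1 / (c.toReal * dist x y) with ha
  refine ⟨N + a, fun D => ?_⟩
  obtain ⟨z, hz, hcz⟩ := key ⌈D⌉₊
  set n := ⌈D⌉₊
  refine ⟨x, z, by linarith [Nat.le_ceil D], ?_⟩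
  have hz0 : 0 < dist x z := hz ▸ by positivity
  have hfin := ne_top_of_le_ne_top hC (hCb x z (dist_pos.1 hz0))
  refine (ENNReal.ofReal_le_iff_le_toReal hfin).2 ?_
  set M := (μ.measure (T.cylinder x z)).toReal
  have h1 : c.toReal ≤ (N : ℝ) ^ n * M := by
    have := ENNReal.toReal_mono (ENNReal.mul_ne_top (by simp) hfin) hcz
    rwa [ENNReal.toReal_mul, ENNReal.toReal_pow, ENNReal.toReal_natCast] at this
  have h2 : (N : ℝ) ^ n / c.toReal ≤ Real.exp ((N + a) * dist x z) := by
    have e1 : (N : ℝ) ^ n ≤ Real.exp (N * n) := by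
      rw [mul_comm, Real.exp_nat_mul]
      gcongr
      linarith [Real.add_one_le_exp (N : ℝ)]
    have e2 : 1 / c.toReal ≤ Real.exp (a * dist x y) := by
      have : a * dist x y = 1 / c.toReal := by
        rw [ha]
        field_simp
      rw [this]
      linarith [Real.add_one_le_exp (1 / c.toReal)]
    calc (N : ℝ) ^ n / c.toReal = (N : ℝ) ^ n * (1 / c.toReal) := by ring
      _ ≤ Real.exp (N * n) * Real.exp (a * dist x y) := by gcongr
      _ = Real.exp (N * n + a * dist x y) := (Real.exp_add _ _).symm
      _ ≤ _ := by
        have : 0 ≤ a := by positivity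
        rw [Real.exp_le_exp, hz]
        have e3 : 0 ≤ (N : ℝ) * dist x y := by positivity
        have e4 : 0 ≤ a * n := by positivity
        linarith
  rw [Real.exp_neg]
  refine inv_le_of_inv_le₀ (hc.trans_le h1 |> fun h => pos_of_mul_pos_right h (by positivity)) ?_
  refine le_trans ?_ h2
  rw [inv_eq_one_div]
  have hM : 0 < M := pos_of_mul_pos_right (hc.trans_le h1) (by positivity)
  rw [div_le_div_iff₀ hM hc, one_mul]
  exact h1

theorem geometricEntropy_nonneg [Finite ι] (T : FreeTree ι) (μ : GeodesicCurrent ι) :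
    0 ≤ T.geometricEntropy μ := by
  by_contra! h
  obtain ⟨s, h1, h2⟩ := EReal.lt_iff_exists_real_btwn.1 h
  exact absurd (hasHeavyCylinders_of_lt h1).nonneg (not_le.2 (by exact_mod_cast h2))

theorem coe_toReal_geometricEntropy [Finite ι] (T : FreeTree ι) (μ : GeodesicCurrent ι)
    (hμ : μ.measure ≠ 0) : ((T.geometricEntropy μ).toReal : EReal) = T.geometricEntropy μ := by
  obtain ⟨s, hs⟩ := T.exists_hasHeavyCylinders μ hμ
  refine EReal.coe_toReal (ne_top_of_le_ne_top (EReal.coe_ne_top s) hs.geometricEntropy_le) ?_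
  exact ne_bot_of_le_ne_bot EReal.zero_ne_bot (T.geometricEntropy_nonneg μ)

theorem HasHeavyCylinders.of_orbit_le [Finite ι] {T T' : FreeTree ι} {μ : GeodesicCurrent ι}
    {p : T} {p' : T'} {r C : ℝ} (hr : 0 < r)
    (hC : ∀ g : FreeGroup ι, dist p' (g • p') ≤ r * dist p (g • p) + C) {s δ : ℝ} (hδ : 0 < δ)
    (h : T'.HasHeavyCylinders μ s) : T.HasHeavyCylinders μ (r * s + δ) := by
  have hs := h.nonneg
  obtain ⟨C₁, hC₁, hsub⟩ := exists_cylinder_subset T T' p p'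
  -- The summands come from trimming the segment in `T`, from the orbit comparison, and from
  -- replacing `x'`, `y'` by orbit points.
  set C₂ := 2 * r * C₁ + |C| + 2 * C₁ with hC₂
  have hC₂' : 0 ≤ C₂ := by positivity
  intro D
  -- Beyond length `s * C₂ / δ` the additive error `s * C₂` in the exponent is at most `δ * dist x
  -- y`.
  set M := max (max D (s * C₂ / δ)) 1
  have hM1 : 1 ≤ M := le_max_right _ _
  obtain ⟨x', y', hd', hm⟩ := h (r * M + C₂)
  have hrM : 0 < r * M := by positivity
  obtain ⟨g, k, hg, hk, hgk⟩ := hsub x' y' (dist_pos.1 (by linarith))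
  have h1 : dist x' y' ≤ r * dist (g • p) (k • p) + |C| + 2 * C₁ := by
    have := hC (g⁻¹ * k)
    rw [← dist_smul_smul_eq, ← dist_smul_smul_eq] at this
    linarith [dist_triangle4 x' (g • p') (k • p') y', dist_comm y' (k • p'), le_abs_self C]
  have h2 : 2 * C₁ < dist (g • p) (k • p) := by
    have : r * (2 * C₁) < r * dist (g • p) (k • p) := by linarith
    exact lt_of_mul_lt_mul_left this hr.le
  obtain ⟨x, y, hxy, hcyl⟩ := hgk h2
  have h3 : dist x' y' ≤ r * dist x y + C₂ := by
    rw [hxy]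
    linarith
  have h4 : M ≤ dist x y := le_of_mul_le_mul_left (by linarith) hr
  refine ⟨x, y, ((le_max_left _ _).trans (le_max_left _ _)).trans h4, le_trans ?_
    (hm.trans (measure_mono hcyl))⟩
  refine ENNReal.ofReal_le_ofReal (Real.exp_le_exp.2 ?_)
  have h5 : s * C₂ ≤ δ * dist x y := by
    have := ((le_max_right D _).trans (le_max_left _ 1)).trans h4
    rw [div_le_iff₀ hδ] at this
    linarith
  have h6 : s * dist x' y' ≤ s * (r * dist x y + C₂) := by gcongr
  linarith

theorem toReal_geometricEntropy_le_mul [Finite ι] {T T' : FreeTree ι} {μ : GeodesicCurrent ι}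
    (hμ : μ.measure ≠ 0) {p : T} {p' : T'} {r C : ℝ} (hr : 0 < r)
    (hC : ∀ g : FreeGroup ι, dist p' (g • p') ≤ r * dist p (g • p) + C) :
    (T.geometricEntropy μ).toReal ≤ r * (T'.geometricEntropy μ).toReal := by
  refine le_of_forall_pos_le_add fun ε hε => ?_
  have h1 : T'.HasHeavyCylinders μ ((T'.geometricEntropy μ).toReal + ε / (2 * r)) := by
    refine hasHeavyCylinders_of_lt ?_
    nth_rw 1 [← T'.coe_toReal_geometricEntropy μ hμ]
    rw [EReal.coe_lt_coe_iff]
    linarith [show 0 < ε / (2 * r) by positivity]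
  have h2 := (h1.of_orbit_le hr hC (half_pos hε)).geometricEntropy_le
  rw [← T.coe_toReal_geometricEntropy μ hμ, EReal.coe_le_coe_iff] at h2
  have h3 : r * (ε / (2 * r)) = ε / 2 := by field_simp
  rw [mul_add, h3] at h2
  linarith

end FreeTree

/-! ### Continuity on `cv(F)` -/

namespace CV

variable {ι : Type u}

/-- The point of `cv(F)` represented by a tree. -/
def mk (T : FreeTree ι) : CV ι := Quotient.mk _ T

theorem mk_surjective : Function.Surjective (mk (ι := ι)) := Quotient.exists_rep

theorem basicNhd_mem_nhds (T : FreeTree ι) (s : Finset T) (A : Finset (FreeGroup ι)) {ε : ℝ}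
    (hε : 0 < ε) : basicNhd T s A ε ∈ 𝓝 (mk T) := by
  refine IsOpen.mem_nhds (TopologicalSpace.isOpen_generateFrom_of_mem ⟨T, s, A, ε, hε, rfl⟩) ?_
  exact ⟨T, rfl, id, fun x _ y _ g _ => by simpa using hε⟩

theorem continuous_toReal_geometricEntropy [Finite ι] (μ : GeodesicCurrent ι)
    (hμ : μ.measure ≠ 0) : Continuous fun X : CV ι => (geometricEntropy μ X).toReal := by
  rw [continuous_iff_continuousAt]
  intro X
  obtain ⟨T, rfl⟩ := mk_surjective X
  rw [Metric.continuousAt_iff']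
  intro ε hε
  obtain ⟨p⟩ := T.isRTree.nonempty
  set e := (T.geometricEntropy μ).toReal
  have he : 0 ≤ e := EReal.toReal_nonneg (T.geometricEntropy_nonneg μ)
  -- The two comparisons bound the difference of entropies by `δ * (1 + δ) * e`, which is at most `2
  -- * (δ * e)` when `δ ≤ 1`.
  obtain ⟨δ, hδ, hδ1, hδe⟩ : ∃ δ : ℝ, 0 < δ ∧ δ ≤ 1 ∧ 2 * (δ * e) < ε := by
    refine ⟨min 1 (ε / (2 * e + 1)), by positivity, min_le_left _ _, ?_⟩
    have h1 : min 1 (ε / (2 * e + 1)) * (2 * e + 1) ≤ ε := by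
      rw [← le_div_iff₀ (by positivity)]
      exact min_le_right _ _
    have h2 : 0 < min 1 (ε / (2 * e + 1)) := by positivity
    linarith
  obtain ⟨A, hA⟩ := T.exists_finset_comparison p hδ
  filter_upwards [basicNhd_mem_nhds T {p} A one_pos] with Y hY
  obtain ⟨T', rfl, f, hf⟩ := hY
  obtain ⟨C, hC⟩ := hA T' (f p) fun g hg =>
    hf p (Finset.mem_singleton_self p) p (Finset.mem_singleton_self p) g hg
  have h1 : e ≤ (1 + δ) * (T'.geometricEntropy μ).toReal :=
    FreeTree.toReal_geometricEntropy_le_mul hμ (by positivity) fun g => (hC g).1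
  have h2 : (T'.geometricEntropy μ).toReal ≤ (1 + δ) * e :=
    FreeTree.toReal_geometricEntropy_le_mul hμ (by positivity) fun g => (hC g).2
  change dist (T'.geometricEntropy μ).toReal e < ε
  have h3 : δ * (T'.geometricEntropy μ).toReal ≤ δ * ((1 + δ) * e) := by gcongr
  have h4 : δ * (δ * e) ≤ 1 * (δ * e) := by gcongr
  have h5 : 0 ≤ δ * e := by positivity
  rw [Real.dist_eq, abs_lt]
  constructor <;> linarith

end CV

end OuterSpace

theorem mainTheorem10 {ι : Type u} [Finite ι] [Nontrivial ι]
    (μ : OuterSpace.GeodesicCurrent ι) (hμ : μ.measure ≠ 0) :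
    ∃ E : OuterSpace.CV ι → ℝ,
      (∀ T : OuterSpace.CV ι, (E T : EReal) = OuterSpace.CV.geometricEntropy μ T) ∧
      Continuous E := by
  refine ⟨fun X => (OuterSpace.CV.geometricEntropy μ X).toReal, fun X => ?_,
    OuterSpace.CV.continuous_toReal_geometricEntropy μ hμ⟩
  obtain ⟨T, rfl⟩ := OuterSpace.CV.mk_surjective X
  exact T.coe_toReal_geometricEntropy μ hμ
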